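/- **Conventions.** Let $W$ have basis $e_1,\dots,e_4$ over an algebraic closure of $\mathbb{C}(t_0,t_1)$, and put $Y=((t_0-1)(1-t_1))^{1/2}$. Let $R\in\mathrm{End}(W\otimes W)$ be the Links–Gould R-matrix, that is, the map with $R(e_1\otimes e_1)=t_0\,e_1\otimes e_1$, $R(e_j\otimes e_j)=-e_j\otimes e_j$ $(j=2,3)$, $R(e_4\otimes e_4)=t_1\,e_4\otimes e_4$; for $j=2,3$, $R(e_1\otimes e_j)=t_0^{1/2}e_j\otimes e_1$, $R(e_j\otimes e_1)=t_0^{1/2}e_1\otimes e_j+(t_0-1)e_j\otimes e_1$, $R(e_j\otimes e_4)=t_1^{1/2}e_4\otimes e_j$, $R(e_4\otimes e_j)=t_1^{1/2}e_j\otimes e_4+(t_1-1)e_4\otimes e_j$; and in the basis $e_1\otimes e_4,\ e_2\otimes e_3,\ e_3\otimes e_2,\ e_4\otimes e_1$ of the remaining invariant subspace $$R=\begin{pmatrix}0&0&0&1\\0&t_0t_1-1&-t_0^{1/2}t_1^{1/2}&-t_0^{1/2}t_1^{1/2}Y\\0&-t_0^{1/2}t_1^{1/2}&0&Y\\1&-t_0^{1/2}t_1^{1/2}Y&Y&Y^2\end{pmatrix}.$$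 Let $\mu=\mathrm{diag}(t_0^{-1},-t_1,-t_0^{-1},t_1)$. The Links–Gould invariant $LG(L)=LG(L;t_0,t_1)$ of an oriented link $L$ is the scalar $c$ with $\mathrm{trace}_{2,\dots,m}\big((\mathrm{id}_W\otimes\mu^{\otimes (m-1)})\circ b_R\big)=c\cdot \mathrm{id}_W$ for every braid $b$ on $m$ strands with closure $L$, where $b_R$ is obtained from $b$ by letting $\sigma_i$ act by $R$ on the $i$-th and $(i+1)$-st factors of $W^{\otimes m}$. Equivalently, $c$ is the scalar by which the associated tangle operator of any long diagram (a diagram cut open at one strand) of $L$ acts on $W$. For $n\in\mathbb{Z}$ let $K_n$ be the twist knot made of a clasp, i.e. two crossings $\sigma^{-1}$ of two parallel strands, and a row of $|2n-1|$ half twists of two antiparallel strands, whose crossings are $\sigma^{-1}$ if $2n-1>0$ and $\sigma$ if $2n-1<0$ (a crossing $\sigma^{\pm1}$ between antiparallel strands means that it becomes $\sigma^{\pm1}$ when turned so that both strands go up). Thus $K_0$ is the unknot and $K_1$ is the trefoil that is the closure of $\sigma_1^{-3}$. For a Laurent polynomial $P=\sum a_{ij}t_0^it_1^j$ let $\mathrm{span}(P)=\max\{i-j: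 a_{ij}\ne0\}-\min\{i-j: a_{ij}\ne0\}$. Put $$a_1(k)=\frac{t_0^kt_1^k-1}{t_0t_1-1},\qquad \tilde a_1(k)=\frac{t_0^{-k}t_1^{-k}-1}{t_0^{-1}t_1^{-1}-1}.$$ **Proposition 2.18.** For every integer $n$, $LG(K_n)$ lies in $\mathbb{Z}[t_0^{\pm1},t_1^{\pm1}]$, and: 1. $LG(K_0)=LG(\bigcirc)=1$, where $\bigcirc$ is the unknot. 2. For $n\ge 1$, $$\begin{aligned}LG(K_n)={}&(-t_0^{-2}t_1^{-1}-t_0^{-1}t_1^{-2}+t_0^{-2}+2t_0^{-1}t_1^{-1}+t_1^{-2}-t_0^{-1}-t_1^{-1}+1)\,(t_0^{-1}t_1^{-1}\tilde a_1(n-1)+1)\\&+(t_0^{-1}-1)^2(t_1^{-1}-1)^2\,\frac{(t_0^{-1}t_1^{-1}+1)\tilde a_1(n-1)-2(n-1)}{t_0^{-1}t_1^{-1}-1}\\&+\tilde a_1(n-1)(t_0^{-1}-1)^2(t_1^{-1}-1)^2-t_0^{-1}t_1^{-1}\tilde a_1(n-1),\end{aligned}$$ and $\mathrm{span}(LG(K_n))=4$.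 3. For $n\le -1$, $$\begin{aligned}LG(K_n)={}&(t_0^{-1}-1)(t_1^{-1}-1)\left(a_1(-n)+(t_0-1)(t_1-1)\frac{2n+a_1(-n)(t_0t_1+1)}{t_0t_1-1}\right)\\&+(t_0-1)(t_1-1)a_1(-n)+1,\end{aligned}$$ and $\mathrm{span}(LG(K_n))=4$. Moreover, for every integer $n$, $LG(K_n)(t_0,-t_0^{-1})=nt_0^2-(2n-1)+nt_0^{-2}$. -/

import Mathlib

noncomputable section

namespace LinksGould

/-! Oriented tangle diagrams, cut into horizontal slices and read from bottom to top. -/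

/-- The direction of a strand where it crosses a horizontal level. -/
inductive Dir
  | up
  | down

/-- The elementary oriented tangles: the two crossings `σ` and `σ⁻¹` of two upward strands, the two
oriented minima and the two oriented maxima. The suffixes `UD` and `DU` give the directions of the
two ends of a minimum or maximum, from left to right. -/
inductive Piece
  | pos
  | neg
  | cupUD
  | cupDU
  | capUD
  | capDU

open Dir Piece

/-- The directions of the bottom ends of an elementary tangle. -/
def Piece.source : Piece → List Dir
  | pos => [up, up]
  | neg => [up, up]
  | cupUD => []
  | cupDU => []
  | capUD => [up, down]
  | capDU => [down, up]

/-- The directions of the top ends of an elementary tangle. -/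
def Piece.target : Piece → List Dir
  | pos => [up, up]
  | neg => [up, up]
  | cupUD => [up, down]
  | cupDU => [down, up]
  | capUD => []
  | capDU => []

/-- A horizontal slice of a diagram: one elementary tangle, with vertical strands to its left and
to its right. -/
structure Slice where
  left : List Dir
  piece : Piece
  right : List Dir

def Slice.source (s : Slice) : List Dir := s.left ++ s.piece.source ++ s.right

def Slice.target (s : Slice) : List Dir := s.left ++ s.piece.target ++ s.right

/-- Adding vertical strands `l` on the left and `r` on the right of a slice. -/
def Slice.pad (l r : List Dir) (s : Slice) : Slice := ⟨l ++ s.left, s.piece, s.right ++ r⟩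

/-- `IsTangle a w b`: the slices `w`, stacked from bottom to top, fit together and form an oriented
tangle diagram with bottom ends `a` and top ends `b`. -/
def IsTangle : List Dir → List Slice → List Dir → Prop
  | a, [], b => a = b
  | a, s :: w, b => s.source = a ∧ IsTangle s.target w b

/-- A long diagram: a diagram with a single open strand, going from bottom to top. Joining the two
ends of this strand gives an oriented link diagram; isotopy classes of long diagrams without closed
components are the same thing as isotopy classes of oriented knots in the three-sphere. -/
def IsLongDiagram (w : List Slice) : Prop := IsTangle [up] w [up]

/-- A crossing `e` turned on its side, between a downward strand (left) and an upward one; at the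
top the upward strand is on the left. -/
def sideDU (e : Piece) : List Slice :=
  [⟨[down, up], cupUD, []⟩, ⟨[down], e, [down]⟩, ⟨[], capDU, [up, down]⟩]

/-- A crossing `e` turned on its side, between an upward strand (left) and a downward one; at the
top the downward strand is on the left. -/
def sideUD (e : Piece) : List Slice :=
  [⟨[], cupDU, [up, down]⟩, ⟨[down], e, [down]⟩, ⟨[down, up], capUD, []⟩]

/-- The local moves between oriented tangle diagrams (Turaev moves): planar isotopies and oriented
Reidemeister moves. -/
inductive LocalMove : List Slice → List Slice → Prop
  /-- Two elementary tangles side by side may exchange their heights. -/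
  | exchange (e f : Piece) (m : List Dir) :
      LocalMove [⟨[], e, m ++ f.source⟩, ⟨e.target ++ m, f, []⟩]
        [⟨e.source ++ m, f, []⟩, ⟨[], e, m ++ f.target⟩]
  /-- Straightening of a strand, four cases. -/
  | zigzag₁ : LocalMove [⟨[], cupUD, [up]⟩, ⟨[up], capDU, []⟩] []
  | zigzag₂ : LocalMove [⟨[up], cupDU, []⟩, ⟨[], capUD, [up]⟩] []
  | zigzag₃ : LocalMove [⟨[], cupDU, [down]⟩, ⟨[down], capUD, []⟩] []
  | zigzag₄ : LocalMove [⟨[down], cupUD, []⟩, ⟨[], capDU, [down]⟩] []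
  /-- A crossing of two downward strands does not depend on the side to which it is rotated. -/
  | rotate (e : Piece) (he : e = pos ∨ e = neg) :
      LocalMove
        [⟨[down, down], cupUD, []⟩, ⟨[down, down, up], cupUD, [down]⟩,
          ⟨[down, down], e, [down, down]⟩,
          ⟨[down], capDU, [up, down, down]⟩, ⟨[], capDU, [down, down]⟩]
        [⟨[], cupDU, [down, down]⟩, ⟨[down], cupDU, [up, down, down]⟩,
          ⟨[down, down], e, [down, down]⟩,
          ⟨[down, down, up], capUD, [down]⟩, ⟨[down, down], capUD, []⟩]
  /-- First Reidemeister move. -/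
  | kink (e : Piece) (he : e = pos ∨ e = neg) :
      LocalMove [⟨[up], cupUD, []⟩, ⟨[], e, [down]⟩, ⟨[up], capUD, []⟩] []
  /-- Second Reidemeister move, parallel strands. -/
  | cancel₁ : LocalMove [⟨[], pos, []⟩, ⟨[], neg, []⟩] []
  | cancel₂ : LocalMove [⟨[], neg, []⟩, ⟨[], pos, []⟩] []
  /-- Second Reidemeister move, antiparallel strands. -/
  | side₁ : LocalMove (sideDU pos ++ sideUD neg) []
  | side₂ : LocalMove (sideDU neg ++ sideUD pos) []
  | side₃ : LocalMove (sideUD pos ++ sideDU neg) []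
  | side₄ : LocalMove (sideUD neg ++ sideDU pos) []
  /-- Third Reidemeister move. -/
  | braid : LocalMove [⟨[], pos, [up]⟩, ⟨[up], pos, []⟩, ⟨[], pos, [up]⟩]
      [⟨[up], pos, []⟩, ⟨[], pos, [up]⟩, ⟨[up], pos, []⟩]

/-- One local move inside a long diagram. -/
def Step (w w' : List Slice) : Prop :=
  IsLongDiagram w ∧ IsLongDiagram w' ∧
    ∃ (u v below above : List Slice) (l r : List Dir), LocalMove u v ∧
      w = below ++ u.map (Slice.pad l r) ++ above ∧ w' = below ++ v.map (Slice.pad l r) ++ above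

/-- Isotopy of long diagrams: the equivalence relation generated by the local moves. -/
def Isotopic : List Slice → List Slice → Prop := Relation.EqvGen Step

/-! Twist knots. -/

/-- `k` successive half twists of two antiparallel strands, all with crossing `e`, starting from
directions (down, up). -/
def halfTwists (e : Piece) : ℕ → List Slice
  | 0 => []
  | k + 1 => halfTwists e k ++ if Even k then sideDU e else sideUD e

/-- The twist knot `K_n`, as a long diagram. Two upward strands pass through a row of `|2n - 1|`
antiparallel half twists (crossings `σ⁻¹` if `2n - 1 > 0` and `σ` if `2n - 1 < 0`), then through a
clasp made of two crossings `σ⁻¹`; finally the right-hand strand is closed up. The row of half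
twists is drawn vertically: its lower left end is led to the top by a minimum on the left and its
upper right end comes from the bottom by a maximum on the right. -/
def twistKnot (n : ℤ) : List Slice :=
  [⟨[up], cupUD, []⟩] ++
  [⟨[], cupUD, [up, up, down]⟩] ++
  (halfTwists (if 0 < 2 * n - 1 then neg else pos) (2 * n - 1).natAbs).map
    (Slice.pad [up] [up, down]) ++
  [⟨[up, up], capDU, [down]⟩] ++
  [⟨[], neg, [down]⟩, ⟨[], neg, [down]⟩] ++
  [⟨[up], capUD, []⟩]

/-- The unknot, as a single vertical strand. -/
def unknot : List Slice := []

/-! Braids. -/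

/-- Words in the Artin generators of the braid group on `m + 1` strands; `(i, true)` is `σ_{i+1}`
and `(i, false)` its inverse. -/
abbrev BraidWord (m : ℕ) := List (Fin m × Bool)

/-- The diagram of a braid word, all strands going up. -/
def BraidWord.diagram {m : ℕ} (b : BraidWord m) : List Slice :=
  b.map fun g => ⟨List.replicate g.1 up, if g.2 then pos else neg,
    List.replicate (m - 1 - g.1) up⟩

/-- The closure of a braid, as a long diagram: all strands but the first are closed up, on the
right. -/
def BraidWord.closure {m : ℕ} (b : BraidWord m) : List Slice :=
  (List.range m).map (fun k => ⟨List.replicate (k + 1) up, cupUD, List.replicate k down⟩) ++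
  b.diagram.map (Slice.pad [] (List.replicate m down)) ++
  ((List.range m).map
    (fun k => ⟨List.replicate (k + 1) up, capUD, List.replicate k down⟩)).reverse

/-! The R-matrix and the operators of diagrams. -/

section Operators

variable {K : Type*} [Field K]

/-- The Links-Gould R-matrix on `W ⊗ W`, where `W` has basis `e_1, …, e_4` (here `0, …, 3`), in
terms of `p = t₀^(1/2)`, `q = t₁^(1/2)` and `y = ((t₀ - 1)(1 - t₁))^(1/2)`. The entry at
`(k, l), (i, j)` is the coefficient of `e_k ⊗ e_l` in the image of `e_i ⊗ e_j`. -/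
def rMatrix (p q y : K) : Matrix (Fin 4 × Fin 4) (Fin 4 × Fin 4) K
  | (0, 0), (0, 0) => p ^ 2
  | (0, 1), (1, 0) => p
  | (1, 0), (0, 1) => p
  | (1, 0), (1, 0) => p ^ 2 - 1
  | (0, 2), (2, 0) => p
  | (2, 0), (0, 2) => p
  | (2, 0), (2, 0) => p ^ 2 - 1
  | (1, 1), (1, 1) => -1
  | (2, 2), (2, 2) => -1
  | (0, 3), (3, 0) => 1
  | (1, 2), (1, 2) => p ^ 2 * q ^ 2 - 1
  | (1, 2), (2, 1) => -(p * q)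
  | (1, 2), (3, 0) => -(p * q * y)
  | (2, 1), (1, 2) => -(p * q)
  | (2, 1), (3, 0) => y
  | (3, 0), (0, 3) => 1
  | (3, 0), (1, 2) => -(p * q * y)
  | (3, 0), (2, 1) => y
  | (3, 0), (3, 0) => y ^ 2
  | (1, 3), (3, 1) => q
  | (3, 1), (1, 3) => q
  | (3, 1), (3, 1) => q ^ 2 - 1
  | (2, 3), (3, 2) => q
  | (3, 2), (2, 3) => q
  | (3, 2), (3, 2) => q ^ 2 - 1
  | (3, 3), (3, 3) => q ^ 2
  | _, _ => 0

/-- The diagonal entries of the map `μ` on `W`. -/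
def muEntry (p q : K) : Fin 4 → K := ![(p ^ 2)⁻¹, -q ^ 2, -(p ^ 2)⁻¹, q ^ 2]

/-- The operator of an elementary tangle on basis vectors. The tensor powers of `W` and of its dual
(for downward strands) are all written in their standard bases, which consist of words in
`Fin 4`; so `List (Fin 4) →₀ K` is the sum of all tensor powers. Crossings act by `R` and `R⁻¹`,
and minima and maxima are normalized so that closing up a strand on the right is a partial trace
weighted by `μ`. -/
def pieceOp (p q y : K) : Piece → List (Fin 4) → (List (Fin 4) →₀ K)
  | pos, [i, j] => ∑ k, ∑ l, Finsupp.single [k, l] (rMatrix p q y (k, l) (i, j))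
  | neg, [i, j] => ∑ k, ∑ l, Finsupp.single [k, l] ((rMatrix p q y)⁻¹ (k, l) (i, j))
  | cupUD, [] => ∑ i, Finsupp.single [i, i] 1
  | cupDU, [] => ∑ i, Finsupp.single [i, i] (muEntry p q i)⁻¹
  | capUD, [i, j] => Finsupp.single [] (if i = j then muEntry p q i else 0)
  | capDU, [i, j] => Finsupp.single [] (if i = j then 1 else 0)
  | _, _ => 0

/-- The operator of a slice: the elementary tangle acts on its tensor factors, the identity acts on
the factors to the left and to the right. -/
def sliceOp (p q y : K) (s : Slice) : (List (Fin 4) →₀ K) →ₗ[K] (List (Fin 4) →₀ K) :=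
  Finsupp.linearCombination K fun x =>
    Finsupp.mapDomain
      (fun z => x.take s.left.length ++ z ++ x.drop (s.left.length + s.piece.source.length))
      (pieceOp p q y s.piece ((x.drop s.left.length).take s.piece.source.length))

/-- The operator of a diagram: the composite of the operators of its slices, bottom slice first. -/
def diagramOp (p q y : K) : List Slice → (List (Fin 4) →₀ K) →ₗ[K] (List (Fin 4) →₀ K)
  | [] => LinearMap.id
  | s :: w => diagramOp p q y w ∘ₗ sliceOp p q y s

/-- The entry at `i, j` of `trace_{2,…,m+1} ((id ⊗ μ^{⊗ m}) ∘ b_R)`, where `b_R` is the operator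
of the braid word `b`, in which `σ_i` acts by `R` on the factors `i, i + 1`. -/
def braidTrace (p q y : K) {m : ℕ} (b : BraidWord m) (i j : Fin 4) : K :=
  ∑ x : Fin m → Fin 4, (∏ k, muEntry p q (x k)) *
    diagramOp p q y b.diagram (Finsupp.single (j :: List.ofFn x) 1) (i :: List.ofFn x)

end Operators

/-! The Links-Gould invariant with generic variables. -/

/-- An algebraic closure of the field of rational functions in two variables. -/
abbrev GenericField := AlgebraicClosure (FractionRing (MvPolynomial (Fin 2) ℂ))

def t₀ : GenericField :=
  algebraMap (FractionRing (MvPolynomial (Fin 2) ℂ)) GenericField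
    (algebraMap (MvPolynomial (Fin 2) ℂ) _ (MvPolynomial.X 0))

def t₁ : GenericField :=
  algebraMap (FractionRing (MvPolynomial (Fin 2) ℂ)) GenericField
    (algebraMap (MvPolynomial (Fin 2) ℂ) _ (MvPolynomial.X 1))

/-- A square root. -/
def root (x : GenericField) : GenericField :=
  Classical.choose (IsAlgClosed.exists_pow_nat_eq x two_pos)

theorem root_sq (x : GenericField) : root x ^ 2 = x :=
  Classical.choose_spec (IsAlgClosed.exists_pow_nat_eq x two_pos)

/-- `c` is the Links-Gould invariant of the oriented link given by the long diagram `w`: for every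
braid whose closure is isotopic to `w`, the weighted partial trace of the operator of the braid
is `c` times the identity of `W`, and more generally the operator of every long diagram isotopic to
`w` acts on `W` as `c` times the identity. -/
structure IsLinksGould (w : List Slice) (c : GenericField) : Prop where
  braid : ∀ (m : ℕ) (b : BraidWord m), Isotopic b.closure w → ∀ i j : Fin 4,
    braidTrace (root t₀) (root t₁) (root ((t₀ - 1) * (1 - t₁))) b i j = if i = j then c else 0
  diagram : ∀ v : List Slice, Isotopic v w → ∀ j : Fin 4,
    diagramOp (root t₀) (root t₁) (root ((t₀ - 1) * (1 - t₁))) v (Finsupp.single [j] 1) =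
      Finsupp.single [j] c

/-! Laurent polynomials in two variables. -/

/-- Laurent polynomials in two variables with integer coefficients; the exponent `(i, j)` stands
for the monomial `t₀^i t₁^j`. -/
abbrev Laurent := AddMonoidAlgebra ℤ (ℤ × ℤ)

/-- The value of a Laurent polynomial at `(x, y)`. -/
def Laurent.eval (P : Laurent) (x y : GenericField) : GenericField :=
  P.coeff.sum fun e c => (c : GenericField) * x ^ e.1 * y ^ e.2

/-- The span: the difference between the largest and the smallest degree of the monomials that
occur in `P`, where `t₀^i t₁^j` has degree `i - j`. -/
def Laurent.span (P : Laurent) : ℤ :=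
  sSup ((fun e : ℤ × ℤ => e.1 - e.2) '' (P.coeff.support : Set (ℤ × ℤ))) -
    sInf ((fun e : ℤ × ℤ => e.1 - e.2) '' (P.coeff.support : Set (ℤ × ℤ)))

/-- `(x^n y^n - 1) / (x y - 1)`. -/
def a₁ (x y : GenericField) (n : ℤ) : GenericField := (x ^ n * y ^ n - 1) / (x * y - 1)

end LinksGould

end

/-!
The theorem has a topological half, invariance of the operators of diagrams, and an algebraic half,
the evaluation of the twist knots.

*Invariance.* Each local move between tangle diagrams, apart from the exchange of heights of distant
elementary tangles, is one of finitely many identities between explicit linear maps whose entries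
are polynomials in `p`, `q`, their inverses, and `y`, where `y ^ 2 = (p ^ 2 - 1) * (1 - q ^ 2)`.
Vectors are represented as lists of monomials (`Term`), on which diagrams act by a computable
function `run`; `diagramOp_eq_of_agreeOn` turns an agreement found by evaluation into an equality of
operators. Together with the locality of slices (`diagramOp_pad`) this gives
`Isotopic.diagramOp_eq`. The closure of a braid acts by its weighted partial trace
(`diagramOp_closure`), so the invariant of a knot can be read off from any one of its long diagrams
(`isLinksGould_of_diagramOp`).

*Twist knots.* For antiparallel strands, three half twists are a linear combination of one half
twist, an opposite half twist and a turnback, that is, a maximum followed by a minimum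
(`diagramOp_three_halfTwists`). A turnback absorbs full twists, so stacking more of them gives the
recurrence `c (m + 2) = (1 + s) * c (m + 1) - s * c m + g` for the invariants in each of the two
families of twist knots, with `s = (t₀ * t₁)⁻¹` or `s = t₀ * t₁`; the increment `g` comes from the
Hopf link that is left when the twisting row is replaced by a turnback. The initial values are those
of the unknot and of the trefoil, and `twistSequence` is the solution.

*Consequences.* Summing the geometric series gives the closed formulas. Sending `t₀^i t₁^j` to
`T^(i-j)` makes `s` equal to `1`, and for nontrivial twist knots the coefficients of `T^2` and
`T^(-2)` become positive integers; as no degrees outside `[-2, 2]` occur, the span is `4`. At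
`t₁ = -t₀⁻¹` one has `s = -1`, the alternating part of the solution vanishes, and what remains is
linear in `n`.
-/

noncomputable section

namespace LinksGould

open Dir Piece

/-! ### Exact computation with diagrams -/

/-- A monomial `coeff * p ^ pExp * q ^ qExp * y ^ ε` times the basis vector `word` of a tensor power
of `W`, with `ε = 1` if `odd` is true and `ε = 0` otherwise. Higher powers of `y` are not needed,
because `y ^ 2` is a polynomial in `p` and `q`. -/
structure Term where
  coeff : ℤ
  pExp : ℤ
  qExp : ℤ
  odd : Bool
  word : List (Fin 4)

namespace Term

/-- The basis vector `x`. -/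
def basis (x : List (Fin 4)) : Term := ⟨1, 0, 0, false, x⟩

/-- The product of the scalars of two terms, on the basis vector `x`; here
`y ^ 2 = p ^ 2 + q ^ 2 - 1 - p ^ 2 * q ^ 2`. -/
def mul (t u : Term) (x : List (Fin 4)) : List Term :=
  let c := t.coeff * u.coeff
  let a := t.pExp + u.pExp
  let b := t.qExp + u.qExp
  if t.odd && u.odd then
    [⟨c, a + 2, b, false, x⟩, ⟨c, a, b + 2, false, x⟩, ⟨-c, a, b, false, x⟩,
      ⟨-c, a + 2, b + 2, false, x⟩]
  else [⟨c, a, b, t.odd || u.odd, x⟩]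

/-- Two terms that differ at most in their coefficients. -/
def Similar (t u : Term) : Prop :=
  t.word = u.word ∧ t.pExp = u.pExp ∧ t.qExp = u.qExp ∧ t.odd = u.odd

instance (t u : Term) : Decidable (Similar t u) := by unfold Similar; infer_instance

/-- Adding a term to a sum of terms, merging it with a similar one. -/
def insert (t : Term) : List Term → List Term
  | [] => [t]
  | u :: v =>
    if Similar t u then
      if t.coeff + u.coeff = 0 then v else { u with coeff := t.coeff + u.coeff } :: v
    else u :: insert t v

end Term

/-- A sum of terms with similar terms merged. -/
def collect (v : List Term) : List Term := v.foldr Term.insert []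

/-- The product of the scalar of a term with a sum of terms. -/
def scale (t : Term) (v : List Term) : List Term := v.flatMap fun u => t.mul u u.word

/-- The columns of `R`. -/
def posTerms : Fin 4 → Fin 4 → List Term
  | 0, 0 => [⟨1, 2, 0, false, [0, 0]⟩]
  | 0, 1 => [⟨1, 1, 0, false, [1, 0]⟩]
  | 0, 2 => [⟨1, 1, 0, false, [2, 0]⟩]
  | 0, 3 => [⟨1, 0, 0, false, [3, 0]⟩]
  | 1, 0 => [⟨1, 1, 0, false, [0, 1]⟩, ⟨1, 2, 0, false, [1, 0]⟩, ⟨-1, 0, 0, false, [1, 0]⟩]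
  | 1, 1 => [⟨-1, 0, 0, false, [1, 1]⟩]
  | 1, 2 => [⟨1, 2, 2, false, [1, 2]⟩, ⟨-1, 0, 0, false, [1, 2]⟩, ⟨-1, 1, 1, false, [2, 1]⟩,
      ⟨-1, 1, 1, true, [3, 0]⟩]
  | 1, 3 => [⟨1, 0, 1, false, [3, 1]⟩]
  | 2, 0 => [⟨1, 1, 0, false, [0, 2]⟩, ⟨1, 2, 0, false, [2, 0]⟩, ⟨-1, 0, 0, false, [2, 0]⟩]
  | 2, 1 => [⟨-1, 1, 1, false, [1, 2]⟩, ⟨1, 0, 0, true, [3, 0]⟩]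
  | 2, 2 => [⟨-1, 0, 0, false, [2, 2]⟩]
  | 2, 3 => [⟨1, 0, 1, false, [3, 2]⟩]
  | 3, 0 => [⟨1, 0, 0, false, [0, 3]⟩, ⟨-1, 1, 1, true, [1, 2]⟩, ⟨1, 0, 0, true, [2, 1]⟩,
      ⟨1, 2, 0, false, [3, 0]⟩, ⟨1, 0, 2, false, [3, 0]⟩, ⟨-1, 0, 0, false, [3, 0]⟩,
      ⟨-1, 2, 2, false, [3, 0]⟩]
  | 3, 1 => [⟨1, 0, 1, false, [1, 3]⟩, ⟨1, 0, 2, false, [3, 1]⟩, ⟨-1, 0, 0, false, [3, 1]⟩]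
  | 3, 2 => [⟨1, 0, 1, false, [2, 3]⟩, ⟨1, 0, 2, false, [3, 2]⟩, ⟨-1, 0, 0, false, [3, 2]⟩]
  | 3, 3 => [⟨1, 0, 2, false, [3, 3]⟩]

/-- The columns of the inverse of `R`. -/
def negTerms : Fin 4 → Fin 4 → List Term
  | 0, 0 => [⟨1, -2, 0, false, [0, 0]⟩]
  | 0, 1 => [⟨1, -1, 0, false, [1, 0]⟩, ⟨1, -2, 0, false, [0, 1]⟩, ⟨-1, 0, 0, false, [0, 1]⟩]
  | 0, 2 => [⟨1, -1, 0, false, [2, 0]⟩, ⟨1, -2, 0, false, [0, 2]⟩, ⟨-1, 0, 0, false, [0, 2]⟩]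
  | 0, 3 => [⟨1, 0, -2, false, [0, 3]⟩, ⟨1, -2, 0, false, [0, 3]⟩, ⟨-1, -2, -2, false, [0, 3]⟩,
      ⟨-1, 0, 0, false, [0, 3]⟩, ⟨1, -1, -1, true, [1, 2]⟩, ⟨-1, -2, -2, true, [2, 1]⟩,
      ⟨1, 0, 0, false, [3, 0]⟩]
  | 1, 0 => [⟨1, -1, 0, false, [0, 1]⟩]
  | 1, 1 => [⟨-1, 0, 0, false, [1, 1]⟩]
  | 1, 2 => [⟨1, -1, -1, true, [0, 3]⟩, ⟨-1, -1, -1, false, [2, 1]⟩]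
  | 1, 3 => [⟨1, 0, -1, false, [3, 1]⟩, ⟨1, 0, -2, false, [1, 3]⟩, ⟨-1, 0, 0, false, [1, 3]⟩]
  | 2, 0 => [⟨1, -1, 0, false, [0, 2]⟩]
  | 2, 1 => [⟨-1, -2, -2, true, [0, 3]⟩, ⟨-1, -1, -1, false, [1, 2]⟩,
      ⟨1, -2, -2, false, [2, 1]⟩, ⟨-1, 0, 0, false, [2, 1]⟩]
  | 2, 2 => [⟨-1, 0, 0, false, [2, 2]⟩]
  | 2, 3 => [⟨1, 0, -1, false, [3, 2]⟩, ⟨1, 0, -2, false, [2, 3]⟩, ⟨-1, 0, 0, false, [2, 3]⟩]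
  | 3, 0 => [⟨1, 0, 0, false, [0, 3]⟩]
  | 3, 1 => [⟨1, 0, -1, false, [1, 3]⟩]
  | 3, 2 => [⟨1, 0, -1, false, [2, 3]⟩]
  | 3, 3 => [⟨1, 0, -2, false, [3, 3]⟩]

/-- The operator of an elementary tangle on basis vectors, in terms of monomials. -/
def pieceTerms : Piece → List (Fin 4) → List Term
  | pos, [i, j] => posTerms i j
  | neg, [i, j] => negTerms i j
  | cupUD, [] => [⟨1, 0, 0, false, [0, 0]⟩, ⟨1, 0, 0, false, [1, 1]⟩, ⟨1, 0, 0, false, [2, 2]⟩,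
      ⟨1, 0, 0, false, [3, 3]⟩]
  | cupDU, [] => [⟨1, 2, 0, false, [0, 0]⟩, ⟨-1, 0, -2, false, [1, 1]⟩,
      ⟨-1, 2, 0, false, [2, 2]⟩, ⟨1, 0, -2, false, [3, 3]⟩]
  | capUD, [i, j] =>
    if i = j then
      [![⟨1, -2, 0, false, []⟩, ⟨-1, 0, 2, false, []⟩, ⟨-1, -2, 0, false, []⟩,
        ⟨1, 0, 2, false, []⟩] i]
    else []
  | capDU, [i, j] => if i = j then [⟨1, 0, 0, false, []⟩] else []
  | _, _ => []

/-- The operator of a slice applied to a single term. -/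
def sliceTerms (s : Slice) (t : Term) : List Term :=
  let l := s.left.length
  let k := s.piece.source.length
  (pieceTerms s.piece ((t.word.drop l).take k)).flatMap fun u =>
    t.mul u (t.word.take l ++ u.word ++ t.word.drop (l + k))

/-- The operator of a diagram applied to a sum of terms. Similar terms are merged after each maximum
only: there they arise in large numbers. -/
def run : List Slice → List Term → List Term
  | [], v => v
  | s :: w, v =>
    run w <| match s.piece.target with
      | [] => collect (v.flatMap (sliceTerms s))
      | _ => v.flatMap (sliceTerms s)

/-- Two sums of terms that agree formally. -/
def agree (v w : List Term) : Bool := (collect (v ++ scale ⟨-1, 0, 0, false, []⟩ w)).isEmpty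

/-- All words of length `n`. -/
def words : ℕ → List (List (Fin 4))
  | 0 => [[]]
  | n + 1 => (words n).flatMap fun x => [0 :: x, 1 :: x, 2 :: x, 3 :: x]

theorem mem_words (x : List (Fin 4)) : x ∈ words x.length := by
  induction x with
  | nil => simp [words]
  | cons i x ih =>
    simp only [List.length_cons, words, List.mem_flatMap]
    refine ⟨x, ih, ?_⟩
    fin_cases i <;> simp

/-- Two diagrams whose operators agree formally on all words of length `n`. -/
def agreeOn (n : ℕ) (w w' : List Slice) : Bool :=
  (words n).all fun x => agree (run w [.basis x]) (run w' [.basis x])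

section Soundness

variable {K : Type*} [Field K]

/-- The scalar of a term. -/
def Term.value (p q y : K) (t : Term) : K :=
  t.coeff * p ^ t.pExp * q ^ t.qExp * if t.odd then y else 1

/-- The vector described by a sum of terms. -/
def vecOf (p q y : K) (v : List Term) : List (Fin 4) →₀ K :=
  (v.map fun t => Finsupp.single t.word (t.value p q y)).sum

variable {p q y : K}

@[simp] theorem vecOf_nil : vecOf p q y [] = 0 := rfl

@[simp] theorem vecOf_cons (t : Term) (v : List Term) :
    vecOf p q y (t :: v) = Finsupp.single t.word (t.value p q y) + vecOf p q y v := by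
  simp [vecOf]

@[simp] theorem vecOf_append (v w : List Term) :
    vecOf p q y (v ++ w) = vecOf p q y v + vecOf p q y w := by
  simp [vecOf]

theorem vecOf_basis (x : List (Fin 4)) : vecOf p q y [.basis x] = Finsupp.single x 1 := by
  simp [Term.basis, Term.value]

theorem vecOf_insert (t : Term) (v : List Term) :
    vecOf p q y (t.insert v) = Finsupp.single t.word (t.value p q y) + vecOf p q y v := by
  induction v with
  | nil => simp [Term.insert]
  | cons u v ih =>
    rw [Term.insert]
    split_ifs with h h0
    · obtain ⟨hw, ha, hb, ho⟩ := h
      have : (t.coeff : K) = -u.coeff := by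
        rw [eq_neg_iff_add_eq_zero]; exact_mod_cast congrArg (Int.cast : ℤ → K) h0
      rw [vecOf_cons, ← add_assoc, hw, ← Finsupp.single_add]
      simp only [Term.value, ha, hb, ho, this, neg_mul, neg_add_cancel, Finsupp.single_zero,
        zero_add]
    · obtain ⟨hw, ha, hb, ho⟩ := h
      rw [vecOf_cons, vecOf_cons, ← add_assoc, hw, ← Finsupp.single_add]
      congr 2
      simp only [Term.value, ha, hb, ho]
      push_cast
      ring
    · rw [vecOf_cons, ih, vecOf_cons]
      abel

theorem vecOf_collect (v : List Term) : vecOf p q y (collect v) = vecOf p q y v := by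
  induction v with
  | nil => rfl
  | cons t v ih =>
    rw [vecOf_cons, ← ih, ← vecOf_insert]
    rfl

theorem vecOf_mul (hp : p ≠ 0) (hq : q ≠ 0) (hy : y ^ 2 = (p ^ 2 - 1) * (1 - q ^ 2))
    (t u : Term) (x : List (Fin 4)) :
    vecOf p q y (t.mul u x) = Finsupp.single x (t.value p q y * u.value p q y) := by
  obtain ⟨c, a, b, o, w⟩ := t
  obtain ⟨c', a', b', o', w'⟩ := u
  cases o <;> cases o' <;>
    simp only [Term.mul, Term.value, Bool.and_false, Bool.and_true, Bool.false_eq_true, if_true,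
      if_false, vecOf_cons, vecOf_nil, add_zero, ← Finsupp.single_add, Bool.or_false,
      Bool.or_true, zpow_add₀ hp, zpow_add₀ hq, Int.cast_mul, Int.cast_neg]
  · congr 1; ring
  · congr 1; ring
  · congr 1; ring
  · congr 1
    simp only [zpow_ofNat]
    linear_combination (-(c : K) * c' * p ^ a * p ^ a' * q ^ b * q ^ b') * hy

theorem vecOf_scale (hp : p ≠ 0) (hq : q ≠ 0) (hy : y ^ 2 = (p ^ 2 - 1) * (1 - q ^ 2))
    (t : Term) (v : List Term) :
    vecOf p q y (scale t v) = t.value p q y • vecOf p q y v := by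
  induction v with
  | nil => simp [scale]
  | cons u v ih =>
    rw [scale, List.flatMap_cons, vecOf_append, vecOf_mul hp hq hy, vecOf_cons, smul_add, ← ih,
      Finsupp.smul_single, smul_eq_mul]
    rfl

theorem vecOf_eq_of_agree (hp : p ≠ 0) (hq : q ≠ 0) (hy : y ^ 2 = (p ^ 2 - 1) * (1 - q ^ 2))
    {v w : List Term} (h : agree v w = true) : vecOf p q y v = vecOf p q y w := by
  rw [agree, List.isEmpty_iff] at h
  have h' := congrArg (vecOf p q y) h
  rw [vecOf_collect, vecOf_append, vecOf_scale hp hq hy] at h'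
  simpa [Term.value, ← sub_eq_add_neg, sub_eq_zero] using h'

/-- The columns of `R` as square matrices: the entry at `k, l` of `columns p q y i j` is the
coefficient of `e_k ⊗ e_l` in the image of `e_i ⊗ e_j`. -/
def columns (p q y : K) : Fin 4 → Fin 4 → Matrix (Fin 4) (Fin 4) K :=
  ![![!![p ^ 2, 0, 0, 0; 0, 0, 0, 0; 0, 0, 0, 0; 0, 0, 0, 0],
      !![0, 0, 0, 0; p, 0, 0, 0; 0, 0, 0, 0; 0, 0, 0, 0],
      !![0, 0, 0, 0; 0, 0, 0, 0; p, 0, 0, 0; 0, 0, 0, 0],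
      !![0, 0, 0, 0; 0, 0, 0, 0; 0, 0, 0, 0; 1, 0, 0, 0]],
    ![!![0, p, 0, 0; p ^ 2 - 1, 0, 0, 0; 0, 0, 0, 0; 0, 0, 0, 0],
      !![0, 0, 0, 0; 0, -1, 0, 0; 0, 0, 0, 0; 0, 0, 0, 0],
      !![0, 0, 0, 0; 0, 0, p ^ 2 * q ^ 2 - 1, 0; 0, -(p * q), 0, 0; -(p * q * y), 0, 0, 0],
      !![0, 0, 0, 0; 0, 0, 0, 0; 0, 0, 0, 0; 0, q, 0, 0]],
    ![!![0, 0, p, 0; 0, 0, 0, 0; p ^ 2 - 1, 0, 0, 0; 0, 0, 0, 0],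
      !![0, 0, 0, 0; 0, 0, -(p * q), 0; 0, 0, 0, 0; y, 0, 0, 0],
      !![0, 0, 0, 0; 0, 0, 0, 0; 0, 0, -1, 0; 0, 0, 0, 0],
      !![0, 0, 0, 0; 0, 0, 0, 0; 0, 0, 0, 0; 0, 0, q, 0]],
    ![!![0, 0, 0, 1; 0, 0, -(p * q * y), 0; 0, y, 0, 0; y ^ 2, 0, 0, 0],
      !![0, 0, 0, 0; 0, 0, 0, q; 0, 0, 0, 0; 0, q ^ 2 - 1, 0, 0],
      !![0, 0, 0, 0; 0, 0, 0, 0; 0, 0, 0, q; 0, 0, q ^ 2 - 1, 0],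
      !![0, 0, 0, 0; 0, 0, 0, 0; 0, 0, 0, 0; 0, 0, 0, q ^ 2]]]

theorem rMatrix_eq_columns (p q y : K) (i j k l : Fin 4) :
    rMatrix p q y (k, l) (i, j) = columns p q y i j k l := by
  fin_cases i <;> fin_cases j <;> fin_cases k <;> fin_cases l <;> rfl

theorem vecOf_posTerms (hy : y ^ 2 = (p ^ 2 - 1) * (1 - q ^ 2)) (i j : Fin 4) :
    vecOf p q y (posTerms i j) =
      ∑ k, ∑ l, Finsupp.single [k, l] (rMatrix p q y (k, l) (i, j)) := by
  have hy' : y ^ 2 = p ^ 2 + (q ^ 2 + (-1 + -(p ^ 2 * q ^ 2))) := by rw [hy]; ring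
  simp only [Fin.sum_univ_four, rMatrix_eq_columns]
  fin_cases i <;> fin_cases j <;>
    simp only [columns, Matrix.of_apply, Matrix.cons_val, Fin.zero_eta, Fin.mk_one,
      Fin.reduceFinMk, posTerms, vecOf_cons, vecOf_nil, Term.value, Finsupp.single_zero, zero_add,
      add_zero, zpow_ofNat, pow_zero, pow_one, Int.cast_one, Int.cast_neg,
      one_mul, mul_one, neg_mul, Bool.false_eq_true, if_true, if_false, hy', sub_eq_add_neg,
      Finsupp.single_add, add_assoc]

end Soundness

section

variable {K : Type*} [Field K] {p q y : K}

/-! ### Correctness of the computation -/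

theorem sliceOp_single (s : Slice) (x : List (Fin 4)) (c : K) :
    sliceOp p q y s (Finsupp.single x c) = c • Finsupp.mapDomain
      (fun z => x.take s.left.length ++ z ++ x.drop (s.left.length + s.piece.source.length))
      (pieceOp p q y s.piece ((x.drop s.left.length).take s.piece.source.length)) := by
  simp [sliceOp]

theorem vecOf_flatMap_mul (hp : p ≠ 0) (hq : q ≠ 0) (hy : y ^ 2 = (p ^ 2 - 1) * (1 - q ^ 2))
    (t : Term) (g : List (Fin 4) → List (Fin 4)) (v : List Term) :
    vecOf p q y (v.flatMap fun u => t.mul u (g u.word)) =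
      t.value p q y • Finsupp.mapDomain g (vecOf p q y v) := by
  induction v with
  | nil => simp
  | cons u v ih =>
    rw [List.flatMap_cons, vecOf_append, vecOf_mul hp hq hy, ih, vecOf_cons, Finsupp.mapDomain_add,
      Finsupp.mapDomain_single, smul_add, Finsupp.smul_single, smul_eq_mul]

theorem sliceOp_vecOf (hp : p ≠ 0) (hq : q ≠ 0) (hy : y ^ 2 = (p ^ 2 - 1) * (1 - q ^ 2)) (s : Slice)
    (hs : ∀ z, vecOf p q y (pieceTerms s.piece z) = pieceOp p q y s.piece z) (v : List Term) :
    sliceOp p q y s (vecOf p q y v) = vecOf p q y (v.flatMap (sliceTerms s)) := by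
  induction v with
  | nil => simp
  | cons t v ih =>
    rw [vecOf_cons, map_add, ih, List.flatMap_cons, vecOf_append, sliceOp_single, sliceTerms,
      vecOf_flatMap_mul hp hq hy t fun z => t.word.take s.left.length ++ z ++
        t.word.drop (s.left.length + s.piece.source.length), hs]

theorem vecOf_pieceTerms_pos (hy : y ^ 2 = (p ^ 2 - 1) * (1 - q ^ 2)) (z : List (Fin 4)) :
    vecOf p q y (pieceTerms pos z) = pieceOp p q y pos z := by
  match z with
  | [] | [_] | _ :: _ :: _ :: _ => rfl
  | [i, j] => exact vecOf_posTerms hy i j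

/-- The inverse of `R`, read off from its columns. -/
def invMatrix (p q y : K) : Matrix (Fin 4 × Fin 4) (Fin 4 × Fin 4) K :=
  fun a b => vecOf p q y (negTerms b.1 b.2) [a.1, a.2]

theorem sum_single_vecOf (v : List Term) (hv : ∀ t ∈ v, t.word.length = 2) :
    ∑ k, ∑ l, Finsupp.single [k, l] (vecOf p q y v [k, l]) = vecOf p q y v := by
  induction v with
  | nil => simp
  | cons t v ih =>
    rw [List.forall_mem_cons] at hv
    obtain ⟨a, b, hab⟩ := List.length_eq_two.1 hv.1
    simp only [vecOf_cons, Finsupp.add_apply, Finsupp.single_add, Finset.sum_add_distrib, ih hv.2,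
      hab]
    rw [Finset.sum_eq_single a, Finset.sum_eq_single b]
    · simp
    all_goals simp +contextual [Finsupp.single_apply]

theorem length_negTerms (i j : Fin 4) : ∀ t ∈ negTerms i j, t.word.length = 2 := by
  have h : ∀ i j, (negTerms i j).all (fun t => t.word.length = 2) = true := by decide +kernel
  simpa using h i j

theorem agree_pos_negTerms (i j : Fin 4) :
    agree ((negTerms i j).flatMap (sliceTerms ⟨[], pos, []⟩)) [.basis [i, j]] = true := by
  revert i j
  decide +kernel

theorem rMatrix_mul_invMatrix (hp : p ≠ 0) (hq : q ≠ 0)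
    (hy : y ^ 2 = (p ^ 2 - 1) * (1 - q ^ 2)) : rMatrix p q y * invMatrix p q y = 1 := by
  ext ⟨k, l⟩ ⟨i, j⟩
  have h := vecOf_eq_of_agree hp hq hy (agree_pos_negTerms i j)
  rw [← sliceOp_vecOf hp hq hy _ (vecOf_pieceTerms_pos hy), vecOf_basis,
    ← sum_single_vecOf _ (length_negTerms i j)] at h
  have h' := DFunLike.congr_fun h [k, l]
  simp only [map_sum, sliceOp_single, Finsupp.finsetSum_apply] at h'
  simp [pieceOp, Piece.source, Finsupp.mapDomain_finsetSum, Finsupp.single_apply] at h'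
  simp only [ite_and, Finset.sum_ite_eq', Finset.mem_univ, if_true, Finset.sum_ite_irrel,
    Finset.sum_const_zero] at h'
  simp only [Matrix.mul_apply, Fintype.sum_prod_type, Matrix.one_apply, Prod.mk.injEq, ite_and,
    eq_comm (a := k), eq_comm (a := l)]
  simpa only [mul_comm, invMatrix] using h'

theorem rMatrix_inv (hp : p ≠ 0) (hq : q ≠ 0) (hy : y ^ 2 = (p ^ 2 - 1) * (1 - q ^ 2)) :
    (rMatrix p q y)⁻¹ = invMatrix p q y :=
  Matrix.inv_eq_right_inv (rMatrix_mul_invMatrix hp hq hy)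

theorem vecOf_pieceTerms (hp : p ≠ 0) (hq : q ≠ 0) (hy : y ^ 2 = (p ^ 2 - 1) * (1 - q ^ 2))
    (e : Piece) (z : List (Fin 4)) :
    vecOf p q y (pieceTerms e z) = pieceOp p q y e z := by
  match e, z with
  | pos, z => exact vecOf_pieceTerms_pos hy z
  | neg, [i, j] =>
    rw [pieceOp, rMatrix_inv hp hq hy]
    exact (sum_single_vecOf _ (length_negTerms i j)).symm
  | neg, [] | neg, [_] | neg, _ :: _ :: _ :: _ => rfl
  | cupUD, [] => simp [pieceTerms, pieceOp, Fin.sum_univ_four, Term.value, add_assoc]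
  | cupDU, [] =>
    simp [pieceTerms, pieceOp, Fin.sum_univ_four, Term.value, add_assoc, muEntry]
  | cupUD, _ :: _ | cupDU, _ :: _ => rfl
  | capUD, [i, j] =>
    fin_cases i <;> fin_cases j <;> simp [pieceTerms, pieceOp, Term.value, muEntry]
  | capUD, [] | capUD, [_] | capUD, _ :: _ :: _ :: _ => rfl
  | capDU, [i, j] => by_cases h : i = j <;> simp [pieceTerms, pieceOp, h, Term.value]
  | capDU, [] | capDU, [_] | capDU, _ :: _ :: _ :: _ => rfl

/-- The exact computation gives the operators of diagrams. -/
theorem diagramOp_vecOf (hp : p ≠ 0) (hq : q ≠ 0) (hy : y ^ 2 = (p ^ 2 - 1) * (1 - q ^ 2))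
    (w : List Slice) (v : List Term) :
    diagramOp p q y w (vecOf p q y v) = vecOf p q y (run w v) := by
  induction w generalizing v with
  | nil => rfl
  | cons s w ih =>
    rw [diagramOp, LinearMap.comp_apply,
      sliceOp_vecOf hp hq hy s fun z => vecOf_pieceTerms hp hq hy _ z, run, ← ih]
    split <;> simp only [vecOf_collect]

/-- A formal agreement, which can be checked by evaluation, is an equality of operators. -/
theorem diagramOp_eq_of_agreeOn (hp : p ≠ 0) (hq : q ≠ 0)
    (hy : y ^ 2 = (p ^ 2 - 1) * (1 - q ^ 2)) {n : ℕ} {w w' : List Slice}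
    (h : agreeOn n w w' = true) {x : List (Fin 4)} (hx : x.length = n) :
    diagramOp p q y w (Finsupp.single x 1) = diagramOp p q y w' (Finsupp.single x 1) := by
  rw [agreeOn, List.all_eq_true] at h
  have := vecOf_eq_of_agree hp hq hy (h x (hx ▸ mem_words x))
  rwa [← diagramOp_vecOf hp hq hy, ← diagramOp_vecOf hp hq hy, vecOf_basis] at this

/-! ### Diagrams and lengths of words -/

/-- The vectors in the tensor power with `n` factors. -/
def power (K : Type*) [Field K] (n : ℕ) : Submodule K (List (Fin 4) →₀ K) :=
  Finsupp.supported K K {x | x.length = n}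

theorem single_mem_power {n : ℕ} {x : List (Fin 4)} (hx : x.length = n) (c : K) :
    Finsupp.single x c ∈ power K n :=
  Finsupp.single_mem_supported K c hx

/-- A linear property holds on a tensor power as soon as it holds on its basis vectors. -/
theorem eq_of_mem_power {V : Type*} [AddCommGroup V] [Module K V] {n : ℕ}
    {f g : (List (Fin 4) →₀ K) →ₗ[K] V}
    (h : ∀ x : List (Fin 4), x.length = n → f (Finsupp.single x 1) = g (Finsupp.single x 1))
    {v : List (Fin 4) →₀ K} (hv : v ∈ power K n) : f v = g v := by
  rw [power, Finsupp.supported_eq_span_single] at hv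
  refine LinearMap.eqOn_span (f := f) (g := g) ?_ hv
  rintro _ ⟨x, hx, rfl⟩
  exact h x hx

theorem map_mem_power {m n : ℕ} {f : (List (Fin 4) →₀ K) →ₗ[K] (List (Fin 4) →₀ K)}
    (h : ∀ x : List (Fin 4), x.length = n → f (Finsupp.single x 1) ∈ power K m)
    {v : List (Fin 4) →₀ K} (hv : v ∈ power K n) : f v ∈ power K m := by
  rw [power, Finsupp.supported_eq_span_single] at hv
  refine (Submodule.span_le (p := (power K m).comap f)).2 ?_ hv
  rintro _ ⟨x, hx, rfl⟩
  exact h x hx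

/-- The identity of the factors to the left and right of a vector. -/
def frame (a b : List (Fin 4)) : (List (Fin 4) →₀ K) →ₗ[K] (List (Fin 4) →₀ K) :=
  Finsupp.lmapDomain K K fun z => a ++ z ++ b

@[simp] theorem frame_single (a b x : List (Fin 4)) (c : K) :
    frame a b (Finsupp.single x c) = Finsupp.single (a ++ x ++ b) c := by
  simp [frame]

theorem frame_frame (a b a' b' : List (Fin 4)) (v : List (Fin 4) →₀ K) :
    frame a b (frame a' b' v) = frame (a ++ a') (b' ++ b) v := by
  induction v using Finsupp.induction_linear with
  | zero => simp
  | add f g hf hg => simp [hf, hg]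
  | single x c => simp

theorem frame_mem_power (a b : List (Fin 4)) {n : ℕ} {v : List (Fin 4) →₀ K} (hv : v ∈ power K n) :
    frame a b v ∈ power K (a.length + n + b.length) :=
  map_mem_power (fun x hx => by
    rw [frame_single]; exact single_mem_power (by simp [hx, add_assoc]) 1) hv

theorem pieceOp_mem_power (e : Piece) (z : List (Fin 4)) :
    pieceOp p q y e z ∈ power K e.target.length := by
  unfold pieceOp
  split <;> first
    | exact Submodule.zero_mem _
    | exact single_mem_power rfl _
    | exact Submodule.sum_mem _ fun _ _ => single_mem_power rfl _
    | exact Submodule.sum_mem _ fun _ _ => Submodule.sum_mem _ fun _ _ => single_mem_power rfl _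

/-- A slice acts by its elementary tangle on the middle part of a word. -/
theorem sliceOp_append (s : Slice) {a z b : List (Fin 4)} (ha : a.length = s.left.length)
    (hz : z.length = s.piece.source.length) :
    sliceOp p q y s (Finsupp.single (a ++ z ++ b) 1) = frame a b (pieceOp p q y s.piece z) := by
  rw [sliceOp_single, one_smul, frame, Finsupp.lmapDomain_apply]
  simp [← ha, ← hz]

/-- Words that fit a slice split accordingly. -/
theorem exists_split {l k r : ℕ} {x : List (Fin 4)} (hx : x.length = l + k + r) :
    ∃ a z b : List (Fin 4), x = a ++ z ++ b ∧ a.length = l ∧ z.length = k ∧ b.length = r :=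
  ⟨x.take l, (x.drop l).take k, x.drop (l + k), by simp [List.take_append_drop, ← List.drop_drop],
    by simp; omega, by simp; omega, by simp; omega⟩

theorem Slice.length_source (s : Slice) :
    s.source.length = s.left.length + s.piece.source.length + s.right.length := by
  simp [Slice.source, add_assoc]

theorem Slice.length_target (s : Slice) :
    s.target.length = s.left.length + s.piece.target.length + s.right.length := by
  simp [Slice.target, add_assoc]

theorem sliceOp_mem_power (s : Slice) {v : List (Fin 4) →₀ K}
    (hv : v ∈ power K s.source.length) : sliceOp p q y s v ∈ power K s.target.length := by
  refine map_mem_power (fun x hx => ?_) hv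
  obtain ⟨a, z, b, rfl, ha, hz, hb⟩ := exists_split (hx.trans s.length_source)
  rw [sliceOp_append s ha hz, s.length_target, ← ha, ← hb]
  exact frame_mem_power a b (pieceOp_mem_power _ _)

theorem diagramOp_append (w w' : List Slice) (v : List (Fin 4) →₀ K) :
    diagramOp p q y (w ++ w') v = diagramOp p q y w' (diagramOp p q y w v) := by
  induction w generalizing v with
  | nil => rfl
  | cons s w ih => exact ih _

theorem isTangle_append {a c : List Dir} {w w' : List Slice} :
    IsTangle a (w ++ w') c ↔ ∃ b, IsTangle a w b ∧ IsTangle b w' c := by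
  induction w generalizing a with
  | nil => simp [IsTangle]
  | cons s w ih =>
    simp only [List.cons_append, IsTangle, ih]
    grind

theorem diagramOp_mem_power {a b : List Dir} {w : List Slice} (hw : IsTangle a w b)
    {v : List (Fin 4) →₀ K} (hv : v ∈ power K a.length) :
    diagramOp p q y w v ∈ power K b.length := by
  induction w generalizing a v with
  | nil => cases hw; exact hv
  | cons s w ih =>
    obtain ⟨rfl, hw⟩ := hw
    exact ih hw (sliceOp_mem_power s hv)

/-- Vertical strands on both sides of a slice act as the identity on their factors. -/
theorem sliceOp_pad {l r : List Dir} (s : Slice) {a b : List (Fin 4)} (ha : a.length = l.length)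
    {v : List (Fin 4) →₀ K} (hv : v ∈ power K s.source.length) :
    sliceOp p q y (s.pad l r) (frame a b v) = frame a b (sliceOp p q y s v) := by
  refine eq_of_mem_power (f := sliceOp p q y (s.pad l r) ∘ₗ frame a b)
    (g := frame a b ∘ₗ sliceOp p q y s) (fun x hx => ?_) hv
  obtain ⟨a', z, b', rfl, ha', hz, -⟩ := exists_split (hx.trans s.length_source)
  rw [LinearMap.comp_apply, LinearMap.comp_apply, sliceOp_append s ha' hz, frame_single,
    frame_frame,
    show a ++ (a' ++ z ++ b') ++ b = (a ++ a') ++ z ++ (b' ++ b) by simp]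
  exact sliceOp_append (s.pad l r) (by simp [Slice.pad, ha, ha']) hz

theorem diagramOp_pad {l r c d : List Dir} {w : List Slice} (hw : IsTangle c w d)
    {a b : List (Fin 4)} (ha : a.length = l.length) {v : List (Fin 4) →₀ K}
    (hv : v ∈ power K c.length) :
    diagramOp p q y (w.map (Slice.pad l r)) (frame a b v) = frame a b (diagramOp p q y w v) := by
  induction w generalizing c v with
  | nil => rfl
  | cons s w ih =>
    obtain ⟨rfl, hw⟩ := hw
    simp only [List.map_cons, diagramOp, LinearMap.comp_apply]
    rw [sliceOp_pad s ha hv, ih hw (sliceOp_mem_power s hv)]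

/-! ### Invariance under isotopy -/

/-- The first of the finitely many identities between operators of diagrams without parameters that
the argument needs. All of them hold formally in the monomials in `p`, `q`, `y` and are verified by
the kernel on each basis word. -/
theorem cancel_agree : agreeOn 2 [⟨[], pos, []⟩, ⟨[], neg, []⟩] [] = true ∧
    agreeOn 2 [⟨[], neg, []⟩, ⟨[], pos, []⟩] [] = true := by
  decide +kernel

theorem zigzag_agree :
    agreeOn 1 [⟨[], cupUD, [up]⟩, ⟨[up], capDU, []⟩] [] = true ∧
    agreeOn 1 [⟨[up], cupDU, []⟩, ⟨[], capUD, [up]⟩] [] = true ∧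
    agreeOn 1 [⟨[], cupDU, [down]⟩, ⟨[down], capUD, []⟩] [] = true ∧
    agreeOn 1 [⟨[down], cupUD, []⟩, ⟨[], capDU, [down]⟩] [] = true := by
  decide +kernel

theorem kink_agree :
    agreeOn 1 [⟨[up], cupUD, []⟩, ⟨[], pos, [down]⟩, ⟨[up], capUD, []⟩] [] = true ∧
    agreeOn 1 [⟨[up], cupUD, []⟩, ⟨[], neg, [down]⟩, ⟨[up], capUD, []⟩] [] = true := by
  decide +kernel

theorem side_agree :
    agreeOn 2 (sideDU pos ++ sideUD neg) [] = true ∧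
    agreeOn 2 (sideDU neg ++ sideUD pos) [] = true ∧
    agreeOn 2 (sideUD pos ++ sideDU neg) [] = true ∧
    agreeOn 2 (sideUD neg ++ sideDU pos) [] = true := by
  decide +kernel

theorem braid_agree :
    agreeOn 3 [⟨[], pos, [up]⟩, ⟨[up], pos, []⟩, ⟨[], pos, [up]⟩]
      [⟨[up], pos, []⟩, ⟨[], pos, [up]⟩, ⟨[up], pos, []⟩] = true := by
  decide +kernel

/-- A crossing rotated by half a turn, with its ends led around on the left at the top. -/
def rotateLeft (e : Piece) : List Slice :=
  [⟨[down, down], cupUD, []⟩, ⟨[down, down, up], cupUD, [down]⟩,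
    ⟨[down, down], e, [down, down]⟩,
    ⟨[down], capDU, [up, down, down]⟩, ⟨[], capDU, [down, down]⟩]

/-- A crossing rotated by half a turn, with its ends led around on the right at the top. -/
def rotateRight (e : Piece) : List Slice :=
  [⟨[], cupDU, [down, down]⟩, ⟨[down], cupDU, [up, down, down]⟩,
    ⟨[down, down], e, [down, down]⟩,
    ⟨[down, down, up], capUD, [down]⟩, ⟨[down, down], capUD, []⟩]

theorem rotate_agree :
    agreeOn 2 (rotateLeft pos) (rotateRight pos) = true ∧
    agreeOn 2 (rotateLeft neg) (rotateRight neg) = true := by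
  decide +kernel

/-- The operator of two elementary tangles side by side, the left one below. -/
theorem exchange_left (e f : Piece) (m : List Dir) {a b c : List (Fin 4)}
    (ha : a.length = e.source.length) (hb : b.length = m.length)
    (hc : c.length = f.source.length) :
    diagramOp p q y [⟨[], e, m ++ f.source⟩, ⟨e.target ++ m, f, []⟩]
        (Finsupp.single (a ++ b ++ c) 1) =
      Finsupp.linearCombination K
        (fun z => frame (z ++ b) [] (pieceOp p q y f c)) (pieceOp p q y e a) := by
  have h1 := sliceOp_append (p := p) (q := q) (y := y) ⟨[], e, m ++ f.source⟩ (a := []) (z := a)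
    (b := b ++ c) rfl ha
  rw [List.nil_append, ← List.append_assoc] at h1
  rw [diagramOp, LinearMap.comp_apply, h1]
  refine eq_of_mem_power
    (f := sliceOp p q y ⟨e.target ++ m, f, []⟩ ∘ₗ frame [] (b ++ c)) (fun z hz => ?_)
    (pieceOp_mem_power e a)
  rw [LinearMap.comp_apply, frame_single, Finsupp.linearCombination_single, one_smul,
    show [] ++ z ++ (b ++ c) = (z ++ b) ++ c ++ [] by simp]
  exact sliceOp_append _ (by simp [hz, hb]) hc

/-- The operator of two elementary tangles side by side, the right one below. -/
theorem exchange_right (e f : Piece) (m : List Dir) {a b c : List (Fin 4)}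
    (ha : a.length = e.source.length) (hb : b.length = m.length)
    (hc : c.length = f.source.length) :
    diagramOp p q y [⟨e.source ++ m, f, []⟩, ⟨[], e, m ++ f.target⟩]
        (Finsupp.single (a ++ b ++ c) 1) =
      Finsupp.linearCombination K
        (fun z => frame [] (b ++ z) (pieceOp p q y e a)) (pieceOp p q y f c) := by
  have h1 := sliceOp_append (p := p) (q := q) (y := y) ⟨e.source ++ m, f, []⟩ (a := a ++ b) (z := c)
    (b := []) (by simp [ha, hb]) hc
  rw [List.append_nil] at h1
  rw [diagramOp, LinearMap.comp_apply, h1]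
  refine eq_of_mem_power
    (f := sliceOp p q y ⟨[], e, m ++ f.target⟩ ∘ₗ frame (a ++ b) []) (fun z hz => ?_)
    (pieceOp_mem_power f c)
  rw [LinearMap.comp_apply, frame_single, Finsupp.linearCombination_single, one_smul,
    show (a ++ b) ++ z ++ [] = [] ++ a ++ (b ++ z) by simp]
  exact sliceOp_append _ rfl ha

/-- Operators on disjoint tensor factors commute. -/
theorem linearCombination_frame_comm (b : List (Fin 4)) (u v : List (Fin 4) →₀ K) :
    Finsupp.linearCombination K (fun z => frame (z ++ b) [] v) u =
      Finsupp.linearCombination K (fun z => frame [] (b ++ z) u) v := by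
  induction u using Finsupp.induction_linear with
  | zero => simp [Finsupp.linearCombination_apply]
  | add f g hf hg =>
    rw [map_add, hf, hg]
    simp [Finsupp.linearCombination_apply, Finsupp.sum_add, smul_add]
  | single x c =>
    induction v using Finsupp.induction_linear with
    | zero => simp
    | add f g hf hg =>
      rw [map_add, ← hf, ← hg]
      simp
    | single x' c' => simp [mul_comm]

/-- A local move relates two tangle diagrams with the same ends and the same operators. -/
theorem LocalMove.exists_isTangle (hp : p ≠ 0) (hq : q ≠ 0)
    (hy : y ^ 2 = (p ^ 2 - 1) * (1 - q ^ 2)) {u v : List Slice} (h : LocalMove u v) :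
    u ≠ [] ∧ ∃ c d, IsTangle c u d ∧ IsTangle c v d ∧
      ∀ x : List (Fin 4), x.length = c.length →
        diagramOp p q y u (Finsupp.single x 1) = diagramOp p q y v (Finsupp.single x 1) := by
  have key : ∀ {n : ℕ} {w w' : List Slice}, agreeOn n w w' = true → ∀ x : List (Fin 4),
      x.length = n → diagramOp p q y w (Finsupp.single x 1) =
        diagramOp p q y w' (Finsupp.single x 1) :=
    fun h _ hx => diagramOp_eq_of_agreeOn hp hq hy h hx
  cases h with
  | exchange e f m =>
    refine ⟨by simp, e.source ++ (m ++ f.source), e.target ++ m ++ f.target, ?_, ?_, ?_⟩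
    · simp [IsTangle, Slice.source, Slice.target]
    · simp [IsTangle, Slice.source, Slice.target]
    · intro x hx
      obtain ⟨a, b, c, rfl, ha, hb, hc⟩ := exists_split (l := e.source.length) (k := m.length)
        (r := f.source.length) (x := x) (by simp [hx, add_assoc])
      rw [exchange_left e f m ha hb hc, exchange_right e f m ha hb hc,
        linearCombination_frame_comm]
  | zigzag₁ =>
    exact ⟨by simp, [up], [up], ⟨rfl, rfl, rfl⟩, rfl, key zigzag_agree.1⟩
  | zigzag₂ =>
    exact ⟨by simp, [up], [up], ⟨rfl, rfl, rfl⟩, rfl, key zigzag_agree.2.1⟩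
  | zigzag₃ =>
    exact ⟨by simp, [down], [down], ⟨rfl, rfl, rfl⟩, rfl, key zigzag_agree.2.2.1⟩
  | zigzag₄ =>
    exact ⟨by simp, [down], [down], ⟨rfl, rfl, rfl⟩, rfl, key zigzag_agree.2.2.2⟩
  | rotate e he =>
    refine ⟨by simp, [down, down], [down, down], ?_⟩
    rcases he with rfl | rfl
    · exact ⟨⟨rfl, rfl, rfl, rfl, rfl, rfl⟩, ⟨rfl, rfl, rfl, rfl, rfl, rfl⟩, key rotate_agree.1⟩
    · exact ⟨⟨rfl, rfl, rfl, rfl, rfl, rfl⟩, ⟨rfl, rfl, rfl, rfl, rfl, rfl⟩, key rotate_agree.2⟩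
  | kink e he =>
    refine ⟨by simp, [up], [up], ?_⟩
    rcases he with rfl | rfl
    · exact ⟨⟨rfl, rfl, rfl, rfl⟩, rfl, key kink_agree.1⟩
    · exact ⟨⟨rfl, rfl, rfl, rfl⟩, rfl, key kink_agree.2⟩
  | cancel₁ =>
    exact ⟨by simp, [up, up], [up, up], ⟨rfl, rfl, rfl⟩, rfl, key cancel_agree.1⟩
  | cancel₂ =>
    exact ⟨by simp, [up, up], [up, up], ⟨rfl, rfl, rfl⟩, rfl, key cancel_agree.2⟩
  | side₁ =>
    exact ⟨by simp [sideDU], [down, up], [down, up], ⟨rfl, rfl, rfl, rfl, rfl, rfl, rfl⟩, rfl,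
      key side_agree.1⟩
  | side₂ =>
    exact ⟨by simp [sideDU], [down, up], [down, up], ⟨rfl, rfl, rfl, rfl, rfl, rfl, rfl⟩, rfl,
      key side_agree.2.1⟩
  | side₃ =>
    exact ⟨by simp [sideUD], [up, down], [up, down], ⟨rfl, rfl, rfl, rfl, rfl, rfl, rfl⟩, rfl,
      key side_agree.2.2.1⟩
  | side₄ =>
    exact ⟨by simp [sideUD], [up, down], [up, down], ⟨rfl, rfl, rfl, rfl, rfl, rfl, rfl⟩, rfl,
      key side_agree.2.2.2⟩
  | braid =>
    exact ⟨by simp, [up, up, up], [up, up, up], ⟨rfl, rfl, rfl, rfl⟩, ⟨rfl, rfl, rfl, rfl⟩,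
      key braid_agree⟩

/-- Diagrams with the same ends and the same operators can be exchanged inside a larger diagram. -/
theorem diagramOp_replace {a d e : List Dir} {l r : List Dir} {u v below above : List Slice}
    (hu : u ≠ []) {c : List Dir} (hcu : IsTangle c u d) (hcv : IsTangle c v d)
    (huv : ∀ x : List (Fin 4), x.length = c.length →
        diagramOp p q y u (Finsupp.single x 1) = diagramOp p q y v (Finsupp.single x 1))
    (hw : IsTangle a (below ++ u.map (Slice.pad l r) ++ above) e)
    {x : List (Fin 4) →₀ K} (hx : x ∈ power K a.length) :
    diagramOp p q y (below ++ u.map (Slice.pad l r) ++ above) x =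
      diagramOp p q y (below ++ v.map (Slice.pad l r) ++ above) x := by
  obtain ⟨b₂, hw, -⟩ := isTangle_append.1 hw
  obtain ⟨b₁, hbelow, hpad⟩ := isTangle_append.1 hw
  -- since `u` is not empty, the level below it determines its bottom ends
  have hb₁ : b₁ = l ++ c ++ r := by
    cases u with
    | nil => exact absurd rfl hu
    | cons s u =>
      rw [← hpad.1, ← hcu.1]
      simp [Slice.source, Slice.pad]
  simp only [diagramOp_append]
  congr 1
  refine eq_of_mem_power (n := b₁.length) (fun z hz => ?_) (diagramOp_mem_power hbelow hx)
  obtain ⟨s, z, t, rfl, hs, hz, ht⟩ := exists_split (l := l.length) (k := c.length) (r := r.length)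
    (x := z) (by simp [hz, hb₁, add_assoc])
  rw [← frame_single, diagramOp_pad hcu hs (single_mem_power hz 1),
    diagramOp_pad hcv hs (single_mem_power hz 1), huv z hz]

/-- The operators of long diagrams are invariant under isotopy. -/
theorem Isotopic.diagramOp_eq (hp : p ≠ 0) (hq : q ≠ 0)
    (hy : y ^ 2 = (p ^ 2 - 1) * (1 - q ^ 2)) {w w' : List Slice} (h : Isotopic w w')
    (j : Fin 4) :
    diagramOp p q y w (Finsupp.single [j] 1) = diagramOp p q y w' (Finsupp.single [j] 1) := by
  induction h with
  | rel w w' h =>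
    obtain ⟨hw, -, u, v, below, above, l, r, hmove, rfl, rfl⟩ := h
    obtain ⟨hu, c, d, hcu, hcv, huv⟩ := hmove.exists_isTangle hp hq hy
    exact diagramOp_replace hu hcu hcv huv hw (single_mem_power rfl 1)
  | refl => rfl
  | symm _ _ _ ih => exact ih.symm
  | trans _ _ _ _ _ ih₁ ih₂ => exact ih₁.trans ih₂

/-! ### Closures of braids -/

theorem sum_snoc {M : Type*} [AddCommMonoid M] {m : ℕ} (f : (Fin (m + 1) → Fin 4) → M) :
    ∑ x, f x = ∑ x : Fin m → Fin 4, ∑ i, f (Fin.snoc x i) := by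
  rw [← (Fin.snocEquiv fun _ => Fin 4).sum_comp, Fintype.sum_prod_type, Finset.sum_comm]
  rfl

theorem ofFn_snoc {m : ℕ} (x : Fin m → Fin 4) (i : Fin 4) :
    List.ofFn (Fin.snoc x i : Fin (m + 1) → Fin 4) = List.ofFn x ++ [i] := by
  rw [List.ofFn_succ']
  simp

/-- The minima on the right of a braid closure create all words followed by their mirror images. -/
theorem diagramOp_cups (j : Fin 4) (m : ℕ) :
    diagramOp p q y
        ((List.range m).map fun k => ⟨List.replicate (k + 1) up, cupUD, List.replicate k down⟩)
        (Finsupp.single [j] 1) =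
      ∑ x : Fin m → Fin 4, Finsupp.single (j :: List.ofFn x ++ (List.ofFn x).reverse) 1 := by
  induction m with
  | zero => simp [diagramOp]
  | succ m ih =>
    rw [List.range_succ, List.map_append, diagramOp_append, ih, map_sum, sum_snoc]
    refine Finset.sum_congr rfl fun x _ => ?_
    have h := sliceOp_append (p := p) (q := q) (y := y)
      ⟨List.replicate (m + 1) up, cupUD, List.replicate m down⟩ (a := j :: List.ofFn x) (z := [])
      (b := (List.ofFn x).reverse) (by simp) rfl
    rw [List.append_nil] at h
    simp only [List.map_cons, List.map_nil, diagramOp, LinearMap.comp_apply, LinearMap.id_apply]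
    rw [h]
    simp only [ofFn_snoc]
    simp [pieceOp, -List.ofFn_succ]

/-- The maxima on the right of a braid closure pair a word with a mirror image. -/
theorem diagramOp_caps_single (i : Fin 4) {m : ℕ} (x : Fin m → Fin 4) (z : List (Fin 4))
    (hz : z.length = m) (c : K) :
    diagramOp p q y
        ((List.range m).map
          fun k => (⟨List.replicate (k + 1) up, capUD, List.replicate k down⟩ : Slice)).reverse
        (Finsupp.single (i :: z ++ (List.ofFn x).reverse) c) =
      Finsupp.single [i] (if z = List.ofFn x then (∏ k, muEntry p q (x k)) * c else 0) := by
  induction m generalizing z c with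
  | zero =>
    obtain rfl := List.length_eq_zero_iff.1 hz
    simp [diagramOp]
  | succ m ih =>
    obtain ⟨z, b, rfl⟩ := (List.eq_nil_or_concat' z).resolve_left (by rintro rfl; simp at hz)
    rw [← Fin.snoc_init_self x]
    generalize Fin.init x = x'
    generalize x (Fin.last m) = a
    have h := sliceOp_append (p := p) (q := q) (y := y)
      ⟨List.replicate (m + 1) up, capUD, List.replicate m down⟩ (a := i :: z) (z := [b, a])
      (b := (List.ofFn x').reverse) (by simpa using hz) rfl
    have h' := congrArg (c • ·) h
    simp only [← map_smul, Finsupp.smul_single, smul_eq_mul, mul_one] at h'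
    rw [List.range_succ, List.map_append, List.reverse_append, ofFn_snoc]
    simp only [List.map_cons, List.map_nil, List.reverse_singleton, List.singleton_append,
      diagramOp, LinearMap.comp_apply, List.reverse_append]
    rw [show i :: (z ++ [b]) ++ (a :: (List.ofFn x').reverse) =
      i :: z ++ [b, a] ++ (List.ofFn x').reverse by simp, h']
    simp only [pieceOp, frame_single, Finsupp.smul_single]
    rw [List.append_nil, ih x' z (by simpa using hz)]
    congr 1
    by_cases hba : b = a
    · subst hba
      simp [Fin.prod_univ_castSucc, mul_assoc, mul_comm c]
    · simp [hba]

theorem BraidWord.isTangle_diagram {m : ℕ} (b : BraidWord m) :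
    IsTangle (List.replicate (m + 1) up) b.diagram (List.replicate (m + 1) up) := by
  induction b with
  | nil => rfl
  | cons g b ih =>
    have hg : ∀ n : ℕ, n < m → List.replicate n up ++ [up, up] ++ List.replicate (m - 1 - n) up =
        List.replicate (m + 1) up := fun n hn => by
      rw [show [up, up] = List.replicate 2 up from rfl, ← List.replicate_add, ← List.replicate_add]
      congr 1
      omega
    have h := hg g.1 g.1.2
    obtain ⟨n, ε⟩ := g
    cases ε
    · exact ⟨h, h.symm ▸ ih⟩
    · exact ⟨h, h.symm ▸ ih⟩

/-- The operator of the closure of a braid is the partial trace of the operator of the braid. -/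
theorem diagramOp_closure {m : ℕ} (b : BraidWord m) (j : Fin 4) :
    diagramOp p q y b.closure (Finsupp.single [j] 1) =
      ∑ i, Finsupp.single [i] (braidTrace p q y b i j) := by
  simp only [BraidWord.closure, diagramOp_append, diagramOp_cups, map_sum, braidTrace]
  simp only [← Finsupp.lsingle_apply (R := K), map_sum]
  rw [Finset.sum_comm]
  refine Finset.sum_congr rfl fun x _ => ?_
  have hx : (j :: List.ofFn x).length = (List.replicate (m + 1) up).length := by simp
  have hpad := diagramOp_pad (p := p) (q := q) (y := y) (l := [])
    (r := List.replicate m down) (a := []) (b := (List.ofFn x).reverse)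
    b.isTangle_diagram rfl (single_mem_power hx 1)
  rw [frame_single, List.nil_append] at hpad
  simp only [Finsupp.lsingle_apply]
  rw [hpad]
  -- the maxima read off from the operator of the braid the words that end in `x`
  have hmem := diagramOp_mem_power (p := p) (q := q) (y := y) b.isTangle_diagram
    (single_mem_power hx 1)
  generalize diagramOp p q y b.diagram (Finsupp.single (j :: List.ofFn x) 1) = v at hmem
  refine (eq_of_mem_power (f := diagramOp p q y _ ∘ₗ frame [] (List.ofFn x).reverse)
    (g := ∑ i, (∏ k, muEntry p q (x k)) •
      (Finsupp.lsingle [i] ∘ₗ Finsupp.lapply (i :: List.ofFn x)))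
    (fun z hz => ?_) hmem).trans ?_
  · obtain ⟨i, z, rfl⟩ := List.exists_cons_of_length_eq_add_one
      (hz.trans (List.length_replicate (n := m + 1) (a := up)))
    rw [LinearMap.comp_apply, frame_single, List.nil_append,
      diagramOp_caps_single i x z (by simpa using hz)]
    simp only [LinearMap.sum_apply, LinearMap.smul_apply, LinearMap.comp_apply,
      Finsupp.lapply_apply, Finsupp.lsingle_apply, Finsupp.single_apply, List.cons.injEq, ite_and]
    rw [Finset.sum_eq_single i]
    · by_cases h : z = List.ofFn x <;> simp [h]
    · intro i' _ hi'
      simp [Ne.symm hi']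
    · simp
  · simp [LinearMap.sum_apply]

/-- A scalar by which the operators of `w` and of all diagrams isotopic to it act determines the
weighted partial traces of the braids with closure `w`. -/
theorem braidTrace_eq (hp : p ≠ 0) (hq : q ≠ 0) (hy : y ^ 2 = (p ^ 2 - 1) * (1 - q ^ 2))
    {w : List Slice} {c : K}
    (hw : ∀ j : Fin 4, diagramOp p q y w (Finsupp.single [j] 1) = Finsupp.single [j] c)
    {m : ℕ} {b : BraidWord m} (h : Isotopic b.closure w) (i j : Fin 4) :
    braidTrace p q y b i j = if i = j then c else 0 := by
  have h' := (h.diagramOp_eq hp hq hy j).trans (hw j)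
  rw [diagramOp_closure] at h'
  have := DFunLike.congr_fun h' [i]
  simpa [Finsupp.finsetSum_apply, Finsupp.single_apply, eq_comm] using this

/-! ### Antiparallel twists -/

/-- A maximum of two antiparallel strands followed by a minimum. -/
def turnback : List Slice := [⟨[], capDU, []⟩, ⟨[], cupUD, []⟩]

/-- The right-hand side of the skein relation for three antiparallel half twists, as a sum of
terms; `k` is `-2` if `e` is `σ⁻¹` and `f` is `σ`, and `2` if it is the other way round. -/
def skeinTerms (e f : Piece) (k : ℤ) (x : List (Fin 4)) : List Term :=
  run (sideDU e) [.basis x] ++ scale ⟨1, k, k, false, []⟩ (run (sideDU e) [.basis x]) ++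
    scale ⟨-1, k, k, false, []⟩ (run (sideDU f) [.basis x]) ++
    scale ⟨-2, k, k, false, []⟩ (run turnback [.basis x]) ++
    scale ⟨2, k, 0, false, []⟩ (run turnback [.basis x]) ++
    scale ⟨2, 0, k, false, []⟩ (run turnback [.basis x]) ++
    scale ⟨-2, 0, 0, false, []⟩ (run turnback [.basis x])

theorem skein_agree :
    (words 2).all (fun x =>
      agree (run (sideDU neg ++ sideUD neg ++ sideDU neg) [.basis x]) (skeinTerms neg pos (-2) x) &&
      agree (run (sideDU pos ++ sideUD pos ++ sideDU pos) [.basis x]) (skeinTerms pos neg 2 x)) =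
      true := by
  decide +kernel

/-- A minimum absorbs a full twist of its two ends. -/
theorem turn_agree :
    agreeOn 0 (⟨[], cupUD, []⟩ :: (sideUD neg ++ sideDU neg)) [⟨[], cupUD, []⟩] = true ∧
    agreeOn 0 (⟨[], cupUD, []⟩ :: (sideUD pos ++ sideDU pos)) [⟨[], cupUD, []⟩] = true := by
  decide +kernel

/-- Admissible choices of the crossing `e` in a row of half twists, of the opposite crossing `f`,
and of the exponent `k` for which `p ^ k * q ^ k` is an eigenvalue of a full twist. -/
def TwistData (e f : Piece) (k : ℤ) : Prop :=
  e = neg ∧ f = pos ∧ k = -2 ∨ e = pos ∧ f = neg ∧ k = 2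

/-- The cubic skein relation of the Links-Gould invariant for antiparallel strands: three half
twists are a linear combination of one half twist, one half twist in the opposite direction, and
a turnback. -/
theorem diagramOp_three_halfTwists (hp : p ≠ 0) (hq : q ≠ 0)
    (hy : y ^ 2 = (p ^ 2 - 1) * (1 - q ^ 2)) {e f : Piece} {k : ℤ} (h : TwistData e f k)
    {v : List (Fin 4) →₀ K} (hv : v ∈ power K 2) :
    diagramOp p q y (sideDU e ++ sideUD e ++ sideDU e) v =
      (1 + p ^ k * q ^ k) • diagramOp p q y (sideDU e) v -
        (p ^ k * q ^ k) • diagramOp p q y (sideDU f) v -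
        (2 * (p ^ k - 1) * (q ^ k - 1)) • diagramOp p q y turnback v := by
  refine eq_of_mem_power (g := (1 + p ^ k * q ^ k) • diagramOp p q y (sideDU e) -
    (p ^ k * q ^ k) • diagramOp p q y (sideDU f) -
    (2 * (p ^ k - 1) * (q ^ k - 1)) • diagramOp p q y turnback) (fun x hx => ?_) hv
  have hx' := List.all_eq_true.1 skein_agree x (hx ▸ mem_words x)
  rw [Bool.and_eq_true] at hx'
  have hag : agree (run (sideDU e ++ sideUD e ++ sideDU e) [.basis x]) (skeinTerms e f k x) =
      true := by
    rcases h with ⟨rfl, rfl, rfl⟩ | ⟨rfl, rfl, rfl⟩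
    exacts [hx'.1, hx'.2]
  have := vecOf_eq_of_agree hp hq hy hag
  simp only [skeinTerms, vecOf_append, vecOf_scale hp hq hy, ← diagramOp_vecOf hp hq hy,
    vecOf_basis] at this
  rw [this]
  simp only [LinearMap.sub_apply, LinearMap.smul_apply, Term.value]
  push_cast
  simp only [zpow_zero]
  module

theorem diagramOp_halfTwist_cancel (hp : p ≠ 0) (hq : q ≠ 0)
    (hy : y ^ 2 = (p ^ 2 - 1) * (1 - q ^ 2)) {e f : Piece} {k : ℤ} (h : TwistData e f k)
    {v : List (Fin 4) →₀ K} (hv : v ∈ power K 2) :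
    diagramOp p q y (sideUD e) (diagramOp p q y (sideDU f) v) = v := by
  rw [← diagramOp_append]
  refine eq_of_mem_power (g := LinearMap.id) (fun x hx => ?_) hv
  rcases h with ⟨rfl, rfl, rfl⟩ | ⟨rfl, rfl, rfl⟩
  exacts [diagramOp_eq_of_agreeOn hp hq hy side_agree.1 hx,
    diagramOp_eq_of_agreeOn hp hq hy side_agree.2.1 hx]

theorem diagramOp_turnback_twist (hp : p ≠ 0) (hq : q ≠ 0)
    (hy : y ^ 2 = (p ^ 2 - 1) * (1 - q ^ 2)) {e f : Piece} {k : ℤ} (h : TwistData e f k)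
    {v : List (Fin 4) →₀ K} (hv : v ∈ power K 2) :
    diagramOp p q y (sideUD e ++ sideDU e) (diagramOp p q y turnback v) =
      diagramOp p q y turnback v := by
  have hv' : sliceOp p q y ⟨[], capDU, []⟩ v ∈ power K 0 :=
    sliceOp_mem_power ⟨[], capDU, []⟩ hv
  refine eq_of_mem_power (f := diagramOp p q y (⟨[], cupUD, []⟩ :: (sideUD e ++ sideDU e)))
    (g := diagramOp p q y [⟨[], cupUD, []⟩]) (fun x hx => ?_) hv'
  rcases h with ⟨rfl, rfl, rfl⟩ | ⟨rfl, rfl, rfl⟩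
  exacts [diagramOp_eq_of_agreeOn hp hq hy turn_agree.1 hx,
    diagramOp_eq_of_agreeOn hp hq hy turn_agree.2 hx]

theorem halfTwists_one (e : Piece) : halfTwists e 1 = sideDU e := rfl

theorem halfTwists_add_two (e : Piece) (k : ℕ) :
    halfTwists e (2 * (k + 1) + 1) = halfTwists e (2 * k + 1) ++ (sideUD e ++ sideDU e) := by
  have h1 : ¬ Even (2 * k + 1) := by simp
  have h2 : Even (2 * k + 1 + 1) := by simp [Nat.even_add_one]
  rw [show 2 * (k + 1) + 1 = (2 * k + 1) + 1 + 1 by ring, halfTwists, halfTwists, if_neg h1,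
    if_pos h2, List.append_assoc]

theorem isTangle_sideDU {e : Piece} (he : e = pos ∨ e = neg) :
    IsTangle [down, up] (sideDU e) [up, down] := by
  rcases he with rfl | rfl <;>
    simp [sideDU, IsTangle, Slice.source, Slice.target, Piece.source, Piece.target]

theorem isTangle_sideUD {e : Piece} (he : e = pos ∨ e = neg) :
    IsTangle [up, down] (sideUD e) [down, up] := by
  rcases he with rfl | rfl <;>
    simp [sideUD, IsTangle, Slice.source, Slice.target, Piece.source, Piece.target]

theorem isTangle_halfTwists {e : Piece} (he : e = pos ∨ e = neg) (k : ℕ) :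
    IsTangle [down, up] (halfTwists e (2 * k + 1)) [up, down] := by
  induction k with
  | zero => exact isTangle_sideDU he
  | succ k ih =>
    rw [halfTwists_add_two]
    exact isTangle_append.2 ⟨_, ih, isTangle_append.2 ⟨_, isTangle_sideUD he, isTangle_sideDU he⟩⟩

/-- The row of half twists that is one full twist shorter than `halfTwists e (2 * m + 1)`; for
`m = 0` this is a single half twist in the opposite direction. -/
def precedingTwists (e f : Piece) : ℕ → List Slice
  | 0 => sideDU f
  | m + 1 => halfTwists e (2 * m + 1)

theorem isTangle_precedingTwists {e f : Piece} (he : e = pos ∨ e = neg) (hf : f = pos ∨ f = neg)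
    (m : ℕ) : IsTangle [down, up] (precedingTwists e f m) [up, down] := by
  cases m with
  | zero => exact isTangle_sideDU hf
  | succ m => exact isTangle_halfTwists he m

/-- The recurrence for odd rows of half twists: stacking further full twists on the skein relation
leaves the turnback unchanged, because a turnback absorbs full twists. -/
theorem diagramOp_halfTwists_recurrence (hp : p ≠ 0) (hq : q ≠ 0)
    (hy : y ^ 2 = (p ^ 2 - 1) * (1 - q ^ 2)) {e f : Piece} {k : ℤ} (h : TwistData e f k) (m : ℕ)
    {v : List (Fin 4) →₀ K} (hv : v ∈ power K 2) :
    diagramOp p q y (halfTwists e (2 * (m + 1) + 1)) v =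
      (1 + p ^ k * q ^ k) • diagramOp p q y (halfTwists e (2 * m + 1)) v -
        (p ^ k * q ^ k) • diagramOp p q y (precedingTwists e f m) v -
        (2 * (p ^ k - 1) * (q ^ k - 1)) • diagramOp p q y turnback v := by
  induction m with
  | zero => exact diagramOp_three_halfTwists hp hq hy h hv
  | succ m ih =>
    rw [halfTwists_add_two, diagramOp_append, ih, map_sub, map_sub, map_smul, map_smul, map_smul,
      diagramOp_turnback_twist hp hq hy h hv, ← diagramOp_append, ← halfTwists_add_two]
    congr 3
    cases m with
    | zero =>
      simp only [precedingTwists, diagramOp_append, diagramOp_halfTwist_cancel hp hq hy h hv]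
      rfl
    | succ m => simp only [precedingTwists, halfTwists_add_two, diagramOp_append]

/-! ### Twist knots -/

/-- The long diagram in which the twisting row of a twist knot is replaced by `w`. -/
def clasped (w : List Slice) : List Slice :=
  [⟨[up], cupUD, []⟩] ++ [⟨[], cupUD, [up, up, down]⟩] ++ w.map (Slice.pad [up] [up, down]) ++
    [⟨[up, up], capDU, [down]⟩] ++ [⟨[], neg, [down]⟩, ⟨[], neg, [down]⟩] ++ [⟨[up], capUD, []⟩]

/-- A linear relation between the operators of twisting rows carries over to the long diagrams. -/
theorem diagramOp_clasped_congr {c : K} {w w₁ w₂ w₃ : List Slice} {a b : K}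
    (hw : IsTangle [down, up] w [up, down])
    (hw₁ : IsTangle [down, up] w₁ [up, down])
    (hw₂ : IsTangle [down, up] w₂ [up, down])
    (hw₃ : IsTangle [down, up] w₃ [up, down])
    (h : ∀ v ∈ power K 2, diagramOp p q y w v =
      a • diagramOp p q y w₁ v - b • diagramOp p q y w₂ v - c • diagramOp p q y w₃ v)
    (j : Fin 4) :
    diagramOp p q y (clasped w) (Finsupp.single [j] 1) =
      a • diagramOp p q y (clasped w₁) (Finsupp.single [j] 1) -
      b • diagramOp p q y (clasped w₂) (Finsupp.single [j] 1) -
      c • diagramOp p q y (clasped w₃) (Finsupp.single [j] 1) := by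
  have hu : diagramOp p q y ([⟨[up], cupUD, []⟩] ++ [⟨[], cupUD, [up, up, down]⟩])
      (Finsupp.single [j] 1) ∈ power K 5 :=
    diagramOp_mem_power (a := [up]) (b := [up, down, up, up, down])
      (by simp [IsTangle, Slice.source, Slice.target, Piece.source, Piece.target])
      (single_mem_power rfl 1)
  simp only [clasped, diagramOp_append] at hu ⊢
  have key := eq_of_mem_power (n := 5) (f := diagramOp p q y (w.map (Slice.pad [up] [up, down])))
    (g := a • diagramOp p q y (w₁.map (Slice.pad [up] [up, down])) -
      b • diagramOp p q y (w₂.map (Slice.pad [up] [up, down])) -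
      c • diagramOp p q y (w₃.map (Slice.pad [up] [up, down]))) (fun x hx => ?_) hu
  · rw [key]
    simp only [LinearMap.sub_apply, LinearMap.smul_apply, map_sub, map_smul]
  · obtain ⟨s, z, t, rfl, hs, hz, -⟩ := exists_split (l := 1) (k := 2) (r := 2) hx
    have hz' := single_mem_power (K := K) hz 1
    simp only [LinearMap.sub_apply, LinearMap.smul_apply]
    rw [← frame_single, diagramOp_pad hw hs hz', diagramOp_pad hw₁ hs hz',
      diagramOp_pad hw₂ hs hz', diagramOp_pad hw₃ hs hz', h _ hz']
    simp only [map_sub, map_smul]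

/-- A single half twist with crossing `σ` cancels a crossing of the clasp. -/
theorem unknot_agree : agreeOn 1 (clasped (sideDU pos)) [] = true := by
  decide +kernel

/-- With a turnback in place of the twisting row, only the clasp is left: the diagram is a Hopf
link. -/
theorem hopf_agree :
    (words 1).all (fun x => agree (run (clasped turnback) [.basis x])
      [⟨1, -2, 0, false, x⟩, ⟨1, 0, -2, false, x⟩, ⟨-1, -2, -2, false, x⟩, ⟨-1, 0, 0, false, x⟩]) =
      true := by
  decide +kernel

theorem trefoil_agree :
    (words 1).all (fun x => agree (run (clasped (sideDU neg)) [.basis x])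
      [⟨-1, -4, -2, false, x⟩, ⟨-1, -2, -4, false, x⟩, ⟨1, -4, 0, false, x⟩,
        ⟨2, -2, -2, false, x⟩, ⟨1, 0, -4, false, x⟩, ⟨-1, -2, 0, false, x⟩,
        ⟨-1, 0, -2, false, x⟩, ⟨1, 0, 0, false, x⟩]) = true := by
  decide +kernel

/-- The Links-Gould invariant of the trefoil that is the closure of `σ₁⁻³`, in terms of the inverses
`a` and `b` of the two variables. -/
def trefoil {R : Type*} [CommRing R] (a b : R) : R :=
  -(a ^ 2 * b) - a * b ^ 2 + a ^ 2 + 2 * a * b + b ^ 2 - a - b + 1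

theorem diagramOp_clasped_unknot (hp : p ≠ 0) (hq : q ≠ 0)
    (hy : y ^ 2 = (p ^ 2 - 1) * (1 - q ^ 2)) (j : Fin 4) :
    diagramOp p q y (clasped (sideDU pos)) (Finsupp.single [j] 1) = Finsupp.single [j] 1 :=
  diagramOp_eq_of_agreeOn hp hq hy unknot_agree rfl

theorem diagramOp_clasped_turnback (hp : p ≠ 0) (hq : q ≠ 0)
    (hy : y ^ 2 = (p ^ 2 - 1) * (1 - q ^ 2)) (j : Fin 4) :
    diagramOp p q y (clasped turnback) (Finsupp.single [j] 1) =
      Finsupp.single [j] (-(((p ^ 2)⁻¹ - 1) * ((q ^ 2)⁻¹ - 1))) := by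
  have := vecOf_eq_of_agree hp hq hy (List.all_eq_true.1 hopf_agree [j] (mem_words [j]))
  rw [← diagramOp_vecOf hp hq hy, vecOf_basis] at this
  rw [this]
  simp only [vecOf_cons, vecOf_nil, ← Finsupp.single_add, add_zero, Term.value]
  congr 1
  push_cast
  simp only [zpow_neg, zpow_ofNat]
  ring

theorem diagramOp_clasped_trefoil (hp : p ≠ 0) (hq : q ≠ 0)
    (hy : y ^ 2 = (p ^ 2 - 1) * (1 - q ^ 2)) (j : Fin 4) :
    diagramOp p q y (clasped (sideDU neg)) (Finsupp.single [j] 1) =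
      Finsupp.single [j] (trefoil (p ^ 2)⁻¹ (q ^ 2)⁻¹) := by
  have := vecOf_eq_of_agree hp hq hy (List.all_eq_true.1 trefoil_agree [j] (mem_words [j]))
  rw [← diagramOp_vecOf hp hq hy, vecOf_basis] at this
  rw [this]
  simp only [vecOf_cons, vecOf_nil, ← Finsupp.single_add, add_zero, Term.value, trefoil]
  congr 1
  push_cast
  simp only [zpow_neg, zpow_ofNat]
  ring

/-- The solution `c` of the recurrence `c (k + 2) = (1 + s) * c (k + 1) - s * c k + g` with
`c 0 = a` and `c 1 = a + d`. -/
def twistSequence {R : Type*} [CommRing R] (s a d g : R) (k : ℕ) : R :=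
  a + d * ∑ i ∈ Finset.range k, s ^ i +
    g * ∑ i ∈ Finset.range k, ∑ l ∈ Finset.range i, s ^ l

theorem twistSequence_add_two {R : Type*} [CommRing R] (s a d g : R) (k : ℕ) :
    twistSequence s a d g (k + 2) =
      (1 + s) * twistSequence s a d g (k + 1) - s * twistSequence s a d g k + g := by
  have h : s * ∑ i ∈ Finset.range k, s ^ i = ∑ i ∈ Finset.range k, s ^ i + s ^ k - 1 := by
    rw [← Finset.sum_range_succ, Finset.sum_range_succ', Finset.mul_sum]
    simp [pow_succ']
  simp only [twistSequence, Finset.sum_range_succ]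
  linear_combination -g * h

theorem map_twistSequence {R S : Type*} [CommRing R] [CommRing S] (φ : R →+* S) (s a d g : R)
    (k : ℕ) :
    φ (twistSequence s a d g k) = twistSequence (φ s) (φ a) (φ d) (φ g) k := by
  simp [twistSequence]

/-- A closed form of the operators of the twist knots, given the values for a single half twist in
the two directions. -/
theorem diagramOp_clasped_halfTwists (hp : p ≠ 0) (hq : q ≠ 0)
    (hy : y ^ 2 = (p ^ 2 - 1) * (1 - q ^ 2)) {e f : Piece} {k : ℤ} (h : TwistData e f k)
    {a b g : K}
    (he : ∀ j, diagramOp p q y (clasped (sideDU e)) (Finsupp.single [j] 1) = Finsupp.single [j] a)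
    (hf : ∀ j, diagramOp p q y (clasped (sideDU f)) (Finsupp.single [j] 1) = Finsupp.single [j] b)
    (hg : g = 2 * (p ^ k - 1) * (q ^ k - 1) * (((p ^ 2)⁻¹ - 1) * ((q ^ 2)⁻¹ - 1)))
    (m : ℕ) (j : Fin 4) :
    diagramOp p q y (clasped (halfTwists e (2 * m + 1))) (Finsupp.single [j] 1) =
      Finsupp.single [j]
        (twistSequence (p ^ k * q ^ k) a (p ^ k * q ^ k * (a - b) + g) g m) := by
  have hef : (e = pos ∨ e = neg) ∧ (f = pos ∨ f = neg) := by
    rcases h with ⟨rfl, rfl, rfl⟩ | ⟨rfl, rfl, rfl⟩ <;> simp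
  have hC : IsTangle [down, up] turnback [up, down] := by
    simp [turnback, IsTangle, Slice.source, Slice.target, Piece.source, Piece.target]
  have hrec : ∀ m, diagramOp p q y (clasped (halfTwists e (2 * (m + 1) + 1)))
      (Finsupp.single [j] 1) =
      (1 + p ^ k * q ^ k) • diagramOp p q y (clasped (halfTwists e (2 * m + 1)))
          (Finsupp.single [j] 1) -
        (p ^ k * q ^ k) • diagramOp p q y (clasped (precedingTwists e f m)) (Finsupp.single [j] 1) -
        (2 * (p ^ k - 1) * (q ^ k - 1)) •
          diagramOp p q y (clasped turnback) (Finsupp.single [j] 1) := fun m =>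
    diagramOp_clasped_congr (isTangle_halfTwists hef.1 _) (isTangle_halfTwists hef.1 _)
      (isTangle_precedingTwists hef.1 hef.2 m)
      hC (fun v hv => diagramOp_halfTwists_recurrence hp hq hy h m hv) j
  induction m using Nat.twoStepInduction with
  | zero => simpa [twistSequence, halfTwists_one] using he j
  | one =>
    rw [hrec 0, precedingTwists, halfTwists_one, he, hf, diagramOp_clasped_turnback hp hq hy]
    simp only [Finsupp.smul_single, ← Finsupp.single_sub]
    congr 1
    simp [twistSequence, hg]
    ring
  | more m ih₁ ih₂ =>
    rw [hrec (m + 1), precedingTwists, ih₂, ih₁, diagramOp_clasped_turnback hp hq hy,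
      twistSequence_add_two]
    simp only [Finsupp.smul_single, ← Finsupp.single_sub]
    congr 1
    rw [hg]
    simp only [smul_eq_mul]
    ring

theorem twistKnot_of_pos (m : ℕ) :
    twistKnot (m + 1) = clasped (halfTwists neg (2 * m + 1)) := by
  rw [twistKnot, clasped, if_pos (by omega),
    show (2 * ((m : ℤ) + 1) - 1).natAbs = 2 * m + 1 by omega]

theorem twistKnot_of_nonpos (m : ℕ) :
    twistKnot (-m) = clasped (halfTwists pos (2 * m + 1)) := by
  rw [twistKnot, clasped, if_neg (by omega),
    show (2 * (-(m : ℤ)) - 1).natAbs = 2 * m + 1 by omega]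

end

/-! ### Laurent polynomials -/

/-- Evaluation at nonzero arguments is a ring homomorphism. -/
theorem Laurent.eval_eq_lift (x y : GenericField) (hx : x ≠ 0) (hy : y ≠ 0) :
    ∃ φ : Laurent →+* GenericField, (∀ P : Laurent, P.eval x y = φ P) ∧
      ∀ i j : ℤ, φ (AddMonoidAlgebra.single (i, j) 1) = x ^ i * y ^ j := by
  let F : Multiplicative (ℤ × ℤ) →* GenericField :=
    { toFun := fun e => x ^ e.toAdd.1 * y ^ e.toAdd.2
      map_one' := by simp
      map_mul' := fun e f => by
        simp only [toAdd_mul, Prod.fst_add, Prod.snd_add, zpow_add₀ hx, zpow_add₀ hy]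
        ring }
  refine ⟨(AddMonoidAlgebra.lift ℤ GenericField (ℤ × ℤ) F).toRingHom, fun P => ?_, fun i j => ?_⟩
  · simp only [Laurent.eval, AlgHom.toRingHom_eq_coe, RingHom.coe_coe,
      AddMonoidAlgebra.lift_apply', eq_intCast, mul_assoc]
    rfl
  · simp [AddMonoidAlgebra.lift_single, F, Algebra.smul_def]

/-- The sum of the coefficients of the monomials of equal degree: `t₀^i t₁^j` goes to `T^(i-j)`. -/
def toDegree : Laurent →+* LaurentPolynomial ℤ :=
  AddMonoidAlgebra.mapDomainRingHom ℤ (AddMonoidHom.fst ℤ ℤ - AddMonoidHom.snd ℤ ℤ)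

theorem toDegree_single (i j : ℤ) :
    toDegree (AddMonoidAlgebra.single (i, j) 1) = LaurentPolynomial.T (i - j) := by
  rw [LaurentPolynomial.T]
  exact AddMonoidAlgebra.mapDomain_single

theorem exists_mem_support_of_coeff_toDegree {P : Laurent} {n : ℤ}
    (h : (toDegree P).coeff n ≠ 0) : ∃ e ∈ P.coeff.support, e.1 - e.2 = n := by
  have h' := Finsupp.mapDomain_support (Finsupp.mem_support_iff.2 h)
  simpa using h'

/-- The degrees of the monomials that occur in `P` lie between `-r` and `r`. -/
def DegreeBound (r : ℤ) (P : Laurent) : Prop := ∀ e ∈ P.coeff.support, |e.1 - e.2| ≤ r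

theorem DegreeBound.mono {r s : ℤ} {P : Laurent} (h : DegreeBound r P) (hrs : r ≤ s) :
    DegreeBound s P := fun e he => (h e he).trans hrs

theorem DegreeBound.add {r : ℤ} {P Q : Laurent} (hP : DegreeBound r P) (hQ : DegreeBound r Q) :
    DegreeBound r (P + Q) := fun e he => by
  rcases Finset.mem_union.1 (Finsupp.support_add he) with h | h
  exacts [hP e h, hQ e h]

theorem DegreeBound.neg {r : ℤ} {P : Laurent} (hP : DegreeBound r P) : DegreeBound r (-P) :=
  fun e he => hP e (by simpa using he)

theorem DegreeBound.sub {r : ℤ} {P Q : Laurent} (hP : DegreeBound r P) (hQ : DegreeBound r Q) :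
    DegreeBound r (P - Q) := by
  rw [sub_eq_add_neg]
  exact hP.add hQ.neg

theorem DegreeBound.mul {r s : ℤ} {P Q : Laurent} (hP : DegreeBound r P) (hQ : DegreeBound s Q) :
    DegreeBound (r + s) (P * Q) := fun e he => by
  classical
  obtain ⟨e', he', f, hf, rfl⟩ :=
    Finset.mem_add.1 (AddMonoidAlgebra.support_coeff_mul_subset P Q he)
  have h1 := hP e' he'
  have h2 := hQ f hf
  rw [abs_le] at *
  simp only [Prod.fst_add, Prod.snd_add]
  constructor <;> linarith [h1.1, h1.2, h2.1, h2.2]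

theorem DegreeBound.single {r : ℤ} {i j : ℤ} (h : |i - j| ≤ r) (c : ℤ) :
    DegreeBound r (AddMonoidAlgebra.single (i, j) c) := fun e he => by
  obtain rfl := Finset.mem_singleton.1 (Finsupp.support_single_subset he)
  exact h

theorem DegreeBound.one : DegreeBound 0 1 := DegreeBound.single (i := 0) (j := 0) (by simp) 1

theorem DegreeBound.pow {P : Laurent} (hP : DegreeBound 0 P) (k : ℕ) : DegreeBound 0 (P ^ k) := by
  induction k with
  | zero => simpa using DegreeBound.one
  | succ k ih => simpa [pow_succ] using ih.mul hP

theorem DegreeBound.sum {r : ℤ} {k : ℕ} {f : ℕ → Laurent} (h : ∀ i, DegreeBound r (f i)) :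
    DegreeBound r (∑ i ∈ Finset.range k, f i) := by
  induction k with
  | zero => intro e he; simp at he
  | succ k ih => rw [Finset.sum_range_succ]; exact ih.add (h k)

theorem DegreeBound.twistSequence {r : ℤ} {s a d g : Laurent} (hs : DegreeBound 0 s)
    (ha : DegreeBound r a) (hd : DegreeBound r d) (hg : DegreeBound r g) (k : ℕ) :
    DegreeBound r (twistSequence s a d g k) := by
  have h : ∀ k, DegreeBound 0 (∑ i ∈ Finset.range k, s ^ i) := fun k => .sum fun i => hs.pow i
  have h1 := hd.mul (h k)
  have h2 := hg.mul (DegreeBound.sum (k := k) h)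
  rw [add_zero] at h1 h2
  exact (ha.add h1).add h2

/-- A polynomial has span `4` if its monomials have degrees between `-2` and `2` and the sums of its
coefficients in these two degrees do not vanish. -/
theorem Laurent.span_eq_four {P : Laurent} (hP : DegreeBound 2 P)
    (h : (toDegree P).coeff 2 ≠ 0) (h' : (toDegree P).coeff (-2) ≠ 0) : P.span = 4 := by
  have hmax : IsGreatest ((fun e : ℤ × ℤ => e.1 - e.2) '' (P.coeff.support : Set (ℤ × ℤ))) 2 := by
    refine ⟨exists_mem_support_of_coeff_toDegree h, ?_⟩
    rintro _ ⟨e, he, rfl⟩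
    exact (abs_le.1 (hP e he)).2
  have hmin : IsLeast ((fun e : ℤ × ℤ => e.1 - e.2) '' (P.coeff.support : Set (ℤ × ℤ))) (-2) := by
    refine ⟨exists_mem_support_of_coeff_toDegree h', ?_⟩
    rintro _ ⟨e, he, rfl⟩
    exact (abs_le.1 (hP e he)).1
  rw [Laurent.span, hmax.csSup_eq, hmin.csInf_eq]
  norm_num

theorem twistSequence_one {R : Type*} [CommRing R] (a d g : R) (k : ℕ) :
    twistSequence 1 a d g k = a + k • d + (∑ i ∈ Finset.range k, i) • g := by
  simp [twistSequence, mul_comm]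

/-! ### The invariants of the twist knots -/

/-- The increment `g` in the recurrence for the invariants of twist knots, in terms of the variables
`x`, `y` of the twisting row and the variables `a`, `b` of the clasp. -/
def increment {R : Type*} [CommRing R] (x y a b : R) : R :=
  2 * (x - 1) * (y - 1) * ((a - 1) * (b - 1))

/-- The Links-Gould polynomials of the twist knots `K_(m+1)`, in terms of `a = t₀⁻¹`, `b = t₁⁻¹`. -/
def negTwist {R : Type*} [CommRing R] (a b : R) (m : ℕ) : R :=
  twistSequence (a * b) (trefoil a b) (a * b * (trefoil a b - 1) + increment a b a b)
    (increment a b a b) m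

/-- The Links-Gould polynomials of the twist knots `K_(-m)`, in terms of `x = t₀`, `y = t₁` and
`a = t₀⁻¹`, `b = t₁⁻¹`. -/
def posTwist {R : Type*} [CommRing R] (x y a b : R) (m : ℕ) : R :=
  twistSequence (x * y) 1 (x * y * (1 - trefoil a b) + increment x y a b) (increment x y a b) m

theorem map_negTwist {R S : Type*} [CommRing R] [CommRing S] (φ : R →+* S) (a b : R) (m : ℕ) :
    φ (negTwist a b m) = negTwist (φ a) (φ b) m := by
  simp [negTwist, map_twistSequence, trefoil, increment, map_ofNat]

theorem map_posTwist {R S : Type*} [CommRing R] [CommRing S] (φ : R →+* S) (x y a b : R) (m : ℕ) :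
    φ (posTwist x y a b m) = posTwist (φ x) (φ y) (φ a) (φ b) m := by
  simp [posTwist, map_twistSequence, trefoil, increment, map_ofNat]

section Operators

variable {K : Type*} [Field K] {p q y : K}

theorem diagramOp_negTwist (hp : p ≠ 0) (hq : q ≠ 0) (hy : y ^ 2 = (p ^ 2 - 1) * (1 - q ^ 2))
    (m : ℕ) (j : Fin 4) :
    diagramOp p q y (twistKnot (m + 1)) (Finsupp.single [j] 1) =
      Finsupp.single [j] (negTwist (p ^ 2)⁻¹ (q ^ 2)⁻¹ m) := by
  rw [twistKnot_of_pos, diagramOp_clasped_halfTwists hp hq hy (Or.inl ⟨rfl, rfl, rfl⟩)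
    (diagramOp_clasped_trefoil hp hq hy) (diagramOp_clasped_unknot hp hq hy) rfl]
  simp only [zpow_neg, zpow_ofNat]
  rfl

theorem diagramOp_posTwist (hp : p ≠ 0) (hq : q ≠ 0) (hy : y ^ 2 = (p ^ 2 - 1) * (1 - q ^ 2))
    (m : ℕ) (j : Fin 4) :
    diagramOp p q y (twistKnot (-m)) (Finsupp.single [j] 1) =
      Finsupp.single [j] (posTwist (p ^ 2) (q ^ 2) (p ^ 2)⁻¹ (q ^ 2)⁻¹ m) := by
  rw [twistKnot_of_nonpos, diagramOp_clasped_halfTwists hp hq hy (Or.inr ⟨rfl, rfl, rfl⟩)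
    (diagramOp_clasped_unknot hp hq hy) (diagramOp_clasped_trefoil hp hq hy) rfl]
  simp only [zpow_ofNat]
  rfl

end Operators

/-- The Laurent polynomial of `K_(m+1)`. -/
def negLaurent (m : ℕ) : Laurent :=
  negTwist (AddMonoidAlgebra.single (-1, 0) 1) (AddMonoidAlgebra.single (0, -1) 1) m

/-- The Laurent polynomial of `K_(-m)`. -/
def posLaurent (m : ℕ) : Laurent :=
  posTwist (AddMonoidAlgebra.single (1, 0) 1) (AddMonoidAlgebra.single (0, 1) 1)
    (AddMonoidAlgebra.single (-1, 0) 1) (AddMonoidAlgebra.single (0, -1) 1) m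

theorem eval_negLaurent {x y : GenericField} (hx : x ≠ 0) (hy : y ≠ 0) (m : ℕ) :
    (negLaurent m).eval x y = negTwist x⁻¹ y⁻¹ m := by
  obtain ⟨φ, hφ, h⟩ := Laurent.eval_eq_lift x y hx hy
  rw [hφ, negLaurent, map_negTwist, h, h]
  simp

theorem eval_posLaurent {x y : GenericField} (hx : x ≠ 0) (hy : y ≠ 0) (m : ℕ) :
    (posLaurent m).eval x y = posTwist x y x⁻¹ y⁻¹ m := by
  obtain ⟨φ, hφ, h⟩ := Laurent.eval_eq_lift x y hx hy
  rw [hφ, posLaurent, map_posTwist, h, h, h, h]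
  simp

open LaurentPolynomial in
theorem trefoil_T : trefoil (T (-1)) (T 1 : LaurentPolynomial ℤ) =
    T 2 + T (-2) - 2 * T 1 - 2 * T (-1) + 3 := by
  have h : (T (-1) : LaurentPolynomial ℤ) * T 1 = 1 := by rw [← T_add]; simp
  have h2 : (T 2 : LaurentPolynomial ℤ) = T 1 * T 1 := by rw [← T_add]; rfl
  have h2' : (T (-2) : LaurentPolynomial ℤ) = T (-1) * T (-1) := by rw [← T_add]; rfl
  rw [trefoil, h2, h2']
  linear_combination (2 - T (-1) - T 1) * h

open LaurentPolynomial in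
theorem increment_T {x y a b : LaurentPolynomial ℤ}
    (h : (x - 1) * (y - 1) = (T (-1) - 1) * (T 1 - 1))
    (h' : (a - 1) * (b - 1) = (T (-1) - 1) * (T 1 - 1)) : increment x y a b =
    2 * T 2 + 2 * T (-2) - 8 * T 1 - 8 * T (-1) + 12 := by
  have h1 : (T (-1) : LaurentPolynomial ℤ) * T 1 = 1 := by rw [← T_add]; simp
  have h2 : (T 2 : LaurentPolynomial ℤ) = T 1 * T 1 := by rw [← T_add]; rfl
  have h2' : (T (-2) : LaurentPolynomial ℤ) = T (-1) * T (-1) := by rw [← T_add]; rfl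
  rw [increment, mul_assoc 2, h, h', h2, h2']
  linear_combination (2 * T (-1) * T 1 - 4 * T (-1) - 4 * T 1 + 10) * h1

open LaurentPolynomial in
theorem coeff_extreme (a b c : ℤ) (n : ℤ) (hn : n = 2 ∨ n = -2) :
    (a • T 2 + a • T (-2) + b • T 1 + b • T (-1) + c • 1 : LaurentPolynomial ℤ).coeff n = a := by
  rcases hn with rfl | rfl <;>
    simp only [AddMonoidAlgebra.coeff_add, AddMonoidAlgebra.coeff_smul, Finsupp.add_apply,
      Finsupp.smul_apply, T_apply, ← T_zero] <;>
    norm_num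

theorem coeff_trefoil (n : ℤ) (hn : n = 2 ∨ n = -2) :
    (trefoil (LaurentPolynomial.T (-1)) (LaurentPolynomial.T 1 : LaurentPolynomial ℤ)).coeff n =
      1 := by
  rw [trefoil_T]
  convert coeff_extreme 1 (-2) 3 n hn using 3
  simp only [zsmul_eq_mul]
  push_cast
  ring

theorem coeff_increment (n : ℤ) (hn : n = 2 ∨ n = -2) {x y a b : LaurentPolynomial ℤ}
    (h : (x - 1) * (y - 1) = (LaurentPolynomial.T (-1) - 1) * (LaurentPolynomial.T 1 - 1))
    (h' : (a - 1) * (b - 1) = (LaurentPolynomial.T (-1) - 1) * (LaurentPolynomial.T 1 - 1)) :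
    (increment x y a b).coeff n = 2 := by
  rw [increment_T h h']
  convert coeff_extreme 2 (-8) 12 n hn using 3
  simp only [zsmul_eq_mul]
  push_cast
  ring

/-- Since `t₀ * t₁` has degree `0`, the recurrence becomes arithmetic of second order, and the
coefficients in the extreme degrees are seen to be positive. -/
theorem coeff_toDegree_negLaurent (m : ℕ) (n : ℤ) (hn : n = 2 ∨ n = -2) :
    (toDegree (negLaurent m)).coeff n = 1 + 3 * m + 2 * ∑ i ∈ Finset.range m, (i : ℤ) := by
  have hT : (LaurentPolynomial.T (-1) : LaurentPolynomial ℤ) * LaurentPolynomial.T 1 = 1 := by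
    rw [← LaurentPolynomial.T_add]; simp
  have h1 : (1 : LaurentPolynomial ℤ).coeff n = 0 := by
    rcases hn with rfl | rfl <;> simp [← LaurentPolynomial.T_zero, LaurentPolynomial.T_apply]
  rw [negLaurent, map_negTwist, toDegree_single, toDegree_single]
  norm_num only
  rw [negTwist, hT, twistSequence_one, one_mul]
  simp only [AddMonoidAlgebra.coeff_add, AddMonoidAlgebra.coeff_sub, AddMonoidAlgebra.coeff_smul,
    Finsupp.add_apply, Finsupp.sub_apply, Finsupp.smul_apply, coeff_trefoil n hn,
    coeff_increment n hn rfl rfl, h1]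
  simp
  ring

theorem coeff_toDegree_posLaurent (m : ℕ) (n : ℤ) (hn : n = 2 ∨ n = -2) :
    (toDegree (posLaurent m)).coeff n = m + 2 * ∑ i ∈ Finset.range m, (i : ℤ) := by
  have hT : (LaurentPolynomial.T 1 : LaurentPolynomial ℤ) * LaurentPolynomial.T (-1) = 1 := by
    rw [← LaurentPolynomial.T_add]; simp
  have h1 : (1 : LaurentPolynomial ℤ).coeff n = 0 := by
    rcases hn with rfl | rfl <;> simp [← LaurentPolynomial.T_zero, LaurentPolynomial.T_apply]
  rw [posLaurent, map_posTwist, toDegree_single, toDegree_single, toDegree_single, toDegree_single]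
  norm_num only
  rw [posTwist, hT, twistSequence_one, one_mul]
  simp only [AddMonoidAlgebra.coeff_add, AddMonoidAlgebra.coeff_sub, AddMonoidAlgebra.coeff_smul,
    Finsupp.add_apply, Finsupp.sub_apply, Finsupp.smul_apply, coeff_trefoil n hn,
    coeff_increment n hn (mul_comm _ _) rfl, h1]
  simp
  ring

theorem DegreeBound.trefoil {a b : Laurent} (ha : DegreeBound 1 a) (hb : DegreeBound 1 b)
    (hab : DegreeBound 0 (a * b)) : DegreeBound 2 (LinksGould.trefoil a b) := by
  have h1 : DegreeBound 1 (a ^ 2 * b) := by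
    rw [show a ^ 2 * b = a * (a * b) by ring]; exact ha.mul hab
  have h2 : DegreeBound 1 (a * b ^ 2) := by
    rw [show a * b ^ 2 = b * (a * b) by ring]; exact hb.mul hab
  have h3 : DegreeBound 0 (2 * a * b) := by
    rw [show 2 * a * b = a * b + a * b by ring]; exact hab.add hab
  have h4 : DegreeBound 2 (a ^ 2) := by rw [sq]; exact ha.mul ha
  have h5 : DegreeBound 2 (b ^ 2) := by rw [sq]; exact hb.mul hb
  exact ((((((((h1.mono one_le_two).neg).sub (h2.mono one_le_two)).add h4).add
    (h3.mono zero_le_two)).add h5).sub (ha.mono one_le_two)).sub (hb.mono one_le_two)).add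
    (DegreeBound.one.mono zero_le_two)

theorem DegreeBound.increment {x y a b : Laurent} (hx : DegreeBound 1 x) (hy : DegreeBound 1 y)
    (hxy : DegreeBound 0 (x * y)) (ha : DegreeBound 1 a) (hb : DegreeBound 1 b)
    (hab : DegreeBound 0 (a * b)) : DegreeBound 2 (LinksGould.increment x y a b) := by
  have key : ∀ {a b : Laurent}, DegreeBound 1 a → DegreeBound 1 b → DegreeBound 0 (a * b) →
      DegreeBound 1 ((a - 1) * (b - 1)) := fun {a b} ha hb hab => by
    rw [show (a - 1) * (b - 1) = a * b - a - b + 1 by ring]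
    exact (((hab.mono zero_le_one).sub ha).sub hb).add (DegreeBound.one.mono zero_le_one)
  have h := (key hx hy hxy).mul (key ha hb hab)
  rw [show LinksGould.increment x y a b = (x - 1) * (y - 1) * ((a - 1) * (b - 1)) +
    (x - 1) * (y - 1) * ((a - 1) * (b - 1)) by rw [LinksGould.increment]; ring]
  exact h.add h

theorem degreeBound_negLaurent (m : ℕ) : DegreeBound 2 (negLaurent m) := by
  have ha : DegreeBound 1 (AddMonoidAlgebra.single (-1, 0) 1) := .single (by simp) 1
  have hb : DegreeBound 1 (AddMonoidAlgebra.single (0, -1) 1) := .single (by simp) 1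
  have hab : DegreeBound 0
      (AddMonoidAlgebra.single (-1, 0) 1 * AddMonoidAlgebra.single (0, -1) 1) := by
    rw [AddMonoidAlgebra.single_mul_single]; exact .single (by simp) _
  have ht := DegreeBound.trefoil ha hb hab
  have hi := DegreeBound.increment ha hb hab ha hb hab
  have hd := hab.mul (ht.sub (DegreeBound.one.mono zero_le_two))
  rw [zero_add] at hd
  exact .twistSequence hab ht (hd.add hi) hi m

theorem degreeBound_posLaurent (m : ℕ) : DegreeBound 2 (posLaurent m) := by
  have ha : DegreeBound 1 (AddMonoidAlgebra.single (-1, 0) 1) := .single (by simp) 1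
  have hb : DegreeBound 1 (AddMonoidAlgebra.single (0, -1) 1) := .single (by simp) 1
  have hab : DegreeBound 0
      (AddMonoidAlgebra.single (-1, 0) 1 * AddMonoidAlgebra.single (0, -1) 1) := by
    rw [AddMonoidAlgebra.single_mul_single]; exact .single (by simp) _
  have hx : DegreeBound 1 (AddMonoidAlgebra.single (1, 0) 1) := .single (by simp) 1
  have hy : DegreeBound 1 (AddMonoidAlgebra.single (0, 1) 1) := .single (by simp) 1
  have hxy : DegreeBound 0
      (AddMonoidAlgebra.single (1, 0) 1 * AddMonoidAlgebra.single (0, 1) 1) := by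
    rw [AddMonoidAlgebra.single_mul_single]; exact .single (by simp) _
  have h1 := DegreeBound.one.mono zero_le_two
  have ht := DegreeBound.trefoil ha hb hab
  have hi := DegreeBound.increment hx hy hxy ha hb hab
  have hd := hxy.mul (h1.sub ht)
  rw [zero_add] at hd
  exact .twistSequence hxy h1 (hd.add hi) hi m

theorem span_negLaurent (m : ℕ) : (negLaurent m).span = 4 := by
  have h : (0 : ℤ) < 1 + 3 * m + 2 * ∑ i ∈ Finset.range m, (i : ℤ) := by positivity
  refine Laurent.span_eq_four (degreeBound_negLaurent m) ?_ ?_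
  · rw [coeff_toDegree_negLaurent m 2 (.inl rfl)]; exact h.ne'
  · rw [coeff_toDegree_negLaurent m (-2) (.inr rfl)]; exact h.ne'

theorem span_posLaurent {m : ℕ} (hm : m ≠ 0) : (posLaurent m).span = 4 := by
  have h : (0 : ℤ) < m + 2 * ∑ i ∈ Finset.range m, (i : ℤ) := by positivity
  refine Laurent.span_eq_four (degreeBound_posLaurent m) ?_ ?_
  · rw [coeff_toDegree_posLaurent m 2 (.inl rfl)]; exact h.ne'
  · rw [coeff_toDegree_posLaurent m (-2) (.inr rfl)]; exact h.ne'

theorem t₀_ne_zero : t₀ ≠ 0 := by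
  simp [t₀]

theorem t₁_ne_zero : t₁ ≠ 0 := by
  simp [t₁]

theorem t₀_mul_t₁_ne_one : t₀ * t₁ ≠ 1 := by
  intro h
  rw [t₀, t₁, ← map_mul, ← map_mul] at h
  rw [← map_one (algebraMap (FractionRing (MvPolynomial (Fin 2) ℂ)) GenericField)] at h
  have h1 := (algebraMap (FractionRing (MvPolynomial (Fin 2) ℂ)) GenericField).injective h
  rw [← map_one
    (algebraMap (MvPolynomial (Fin 2) ℂ) (FractionRing (MvPolynomial (Fin 2) ℂ)))] at h1
  have h2 := IsFractionRing.injective (MvPolynomial (Fin 2) ℂ) _ h1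
  have h3 := congrArg (MvPolynomial.eval (0 : Fin 2 → ℂ)) h2
  simp at h3

/-! ### Closed formulas -/

theorem twistSequence_eq_div {K : Type*} [Field K] {s : K} (hs : s ≠ 1) (a d g : K) (k : ℕ) :
    twistSequence s a d g k =
      a + d * ((s ^ k - 1) / (s - 1)) + g * (((s ^ k - 1) / (s - 1) - k) / (s - 1)) := by
  have hs' : s - 1 ≠ 0 := sub_ne_zero.2 hs
  simp only [twistSequence, geom_sum_eq hs, ← Finset.sum_div, Finset.sum_sub_distrib,
    Finset.sum_const, Finset.card_range, nsmul_eq_mul, mul_one]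

theorem a₁_natCast (x y : GenericField) (k : ℕ) :
    a₁ x y k = ((x * y) ^ k - 1) / (x * y - 1) := by
  rw [a₁, zpow_natCast, zpow_natCast, mul_pow]

theorem negTwist_eq {a b : GenericField} (h : a * b ≠ 1) (m : ℕ) :
    negTwist a b m =
      (-(a ^ 2 * b) - a * b ^ 2 + a ^ 2 + 2 * a * b + b ^ 2 - a - b + 1) * (a * b * a₁ a b m + 1)
        + (a - 1) ^ 2 * (b - 1) ^ 2 * (((a * b + 1) * a₁ a b m - 2 * (m : GenericField)) /
            (a * b - 1))
        + a₁ a b m * (a - 1) ^ 2 * (b - 1) ^ 2 - a * b * a₁ a b m := by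
  have h' : a * b - 1 ≠ 0 := sub_ne_zero.2 h
  rw [negTwist, twistSequence_eq_div h, ← a₁_natCast, trefoil, increment]
  generalize a₁ a b m = A
  field_simp
  ring

theorem posTwist_eq {x y : GenericField} (hx : x ≠ 0) (hy : y ≠ 0) (h : x * y ≠ 1) (m : ℕ) :
    posTwist x y x⁻¹ y⁻¹ m =
      (x⁻¹ - 1) * (y⁻¹ - 1) * (a₁ x y m + (x - 1) * (y - 1) *
          ((-2 * (m : GenericField) + a₁ x y m * (x * y + 1)) / (x * y - 1)))
        + (x - 1) * (y - 1) * a₁ x y m + 1 := by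
  have h' : x * y - 1 ≠ 0 := sub_ne_zero.2 h
  rw [posTwist, twistSequence_eq_div h, ← a₁_natCast, trefoil, increment]
  generalize a₁ x y m = A
  field_simp
  ring

/-- At `s = -1` the geometric sums alternate; in both families of twist knots `2 * d = g`, so that
only the linear part in `k` survives. -/
theorem two_mul_twistSequence_neg_one {R : Type*} [CommRing R] (a d g : R) (k : ℕ) :
    2 * twistSequence (-1) a d g k =
      2 * a + g * k + (2 * d - g) * ∑ i ∈ Finset.range k, (-1 : R) ^ i := by
  have h : ∀ k : ℕ, 2 * ∑ i ∈ Finset.range k, (-1 : R) ^ i = 1 - (-1) ^ k := fun k => by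
    induction k with
    | zero => simp
    | succ k ih => rw [Finset.sum_range_succ, mul_add, ih]; ring
  have h' : 2 * ∑ i ∈ Finset.range k, ∑ l ∈ Finset.range i, (-1 : R) ^ l =
      k - ∑ i ∈ Finset.range k, (-1 : R) ^ i := by
    rw [Finset.mul_sum]
    simp only [h, Finset.sum_sub_distrib, Finset.sum_const, Finset.card_range, nsmul_eq_mul,
      mul_one]
  rw [twistSequence]
  linear_combination g * h'

theorem negTwist_specialization {a b : GenericField} (h : a * b = -1) (m : ℕ) :
    negTwist a b m = (m + 1) * (a ^ 2 + b ^ 2) - (2 * m + 1) := by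
  apply mul_left_cancel₀ (two_ne_zero' GenericField)
  rw [negTwist, h, two_mul_twistSequence_neg_one]
  have ht : trefoil a b = a ^ 2 + b ^ 2 - 1 := by
    rw [trefoil]
    linear_combination (2 - a - b) * h
  have hi : increment a b a b = 2 * (a ^ 2 + b ^ 2 - 2) := by
    rw [increment]
    linear_combination (2 * a * b - 4 * a - 4 * b + 6) * h
  rw [ht, hi]
  ring

theorem posTwist_specialization {x y a b : GenericField} (h : a * b = -1) (hx : x = -b)
    (hy : y = -a) (m : ℕ) :
    posTwist x y a b m = -m * (a ^ 2 + b ^ 2) + (2 * m + 1) := by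
  apply mul_left_cancel₀ (two_ne_zero' GenericField)
  subst hx hy
  rw [posTwist, show -b * -a = -1 by rw [neg_mul_neg, mul_comm, h], two_mul_twistSequence_neg_one]
  have ht : trefoil a b = a ^ 2 + b ^ 2 - 1 := by
    rw [trefoil]
    linear_combination (2 - a - b) * h
  have hi : increment (-b) (-a) a b = -2 * (a ^ 2 + b ^ 2 - 2) := by
    rw [increment]
    linear_combination (2 * a * b - 2 : GenericField) * h
  rw [ht, hi]
  ring

/-- The invariant can be computed on a single long diagram. -/
theorem isLinksGould_of_diagramOp {w : List Slice} {c : GenericField}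
    (h : ∀ p q y : GenericField, p ^ 2 = t₀ → q ^ 2 = t₁ → y ^ 2 = (t₀ - 1) * (1 - t₁) →
      p ≠ 0 → q ≠ 0 → ∀ j : Fin 4,
      diagramOp p q y w (Finsupp.single [j] 1) = Finsupp.single [j] c) : IsLinksGould w c := by
  have hp : root t₀ ≠ 0 := fun h => t₀_ne_zero (by rw [← root_sq t₀, h]; simp)
  have hq : root t₁ ≠ 0 := fun h => t₁_ne_zero (by rw [← root_sq t₁, h]; simp)
  have hy := root_sq ((t₀ - 1) * (1 - t₁))
  have hw := h _ _ _ (root_sq t₀) (root_sq t₁) hy hp hq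
  have hy' : root ((t₀ - 1) * (1 - t₁)) ^ 2 = (root t₀ ^ 2 - 1) * (1 - root t₁ ^ 2) := by
    rw [hy, root_sq, root_sq]
  exact ⟨fun m b hb i j => braidTrace_eq hp hq hy' hw hb i j,
    fun v hv j => (hv.diagramOp_eq hp hq hy' j).trans (hw j)⟩

end LinksGould

end

open LinksGould in
theorem proposition2p18 (n : ℤ) :
    IsLinksGould unknot 1 ∧
    ∃ P : Laurent,
      IsLinksGould (twistKnot n) (P.eval t₀ t₁) ∧
      (n = 0 → P = 1) ∧
      (1 ≤ n → P.eval t₀ t₁ =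
        (-(t₀⁻¹ ^ 2 * t₁⁻¹) - t₀⁻¹ * t₁⁻¹ ^ 2 + t₀⁻¹ ^ 2 + 2 * t₀⁻¹ * t₁⁻¹ + t₁⁻¹ ^ 2
            - t₀⁻¹ - t₁⁻¹ + 1) * (t₀⁻¹ * t₁⁻¹ * a₁ t₀⁻¹ t₁⁻¹ (n - 1) + 1)
          + (t₀⁻¹ - 1) ^ 2 * (t₁⁻¹ - 1) ^ 2 *
            (((t₀⁻¹ * t₁⁻¹ + 1) * a₁ t₀⁻¹ t₁⁻¹ (n - 1) - 2 * ((n : GenericField) - 1)) /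
              (t₀⁻¹ * t₁⁻¹ - 1))
          + a₁ t₀⁻¹ t₁⁻¹ (n - 1) * (t₀⁻¹ - 1) ^ 2 * (t₁⁻¹ - 1) ^ 2
          - t₀⁻¹ * t₁⁻¹ * a₁ t₀⁻¹ t₁⁻¹ (n - 1)) ∧
      (n ≤ -1 → P.eval t₀ t₁ =
        (t₀⁻¹ - 1) * (t₁⁻¹ - 1) *
            (a₁ t₀ t₁ (-n) + (t₀ - 1) * (t₁ - 1) *
              ((2 * (n : GenericField) + a₁ t₀ t₁ (-n) * (t₀ * t₁ + 1)) / (t₀ * t₁ - 1)))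
          + (t₀ - 1) * (t₁ - 1) * a₁ t₀ t₁ (-n) + 1) ∧
      (n ≠ 0 → P.span = 4) ∧
      P.eval t₀ (-t₀⁻¹) =
        (n : GenericField) * t₀ ^ 2 - (2 * (n : GenericField) - 1)
          + (n : GenericField) * t₀⁻¹ ^ 2 := by
  constructor
  · exact isLinksGould_of_diagramOp fun p q y _ _ _ _ _ j => rfl
  rcases lt_or_ge 0 n with hn | hn
  · obtain ⟨m, rfl⟩ : ∃ m : ℕ, n = m + 1 := ⟨(n - 1).toNat, by omega⟩
    refine ⟨negLaurent m, isLinksGould_of_diagramOp fun p q y hp hq hy hp0 hq0 j => ?_, by omega,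
      fun _ => ?_, by omega, fun _ => span_negLaurent m, ?_⟩
    · rw [eval_negLaurent t₀_ne_zero t₁_ne_zero, diagramOp_negTwist hp0 hq0 (by rw [hp, hq, hy]),
        hp, hq]
    · rw [eval_negLaurent t₀_ne_zero t₁_ne_zero, negTwist_eq, add_sub_cancel_right]
      · push_cast
        rw [add_sub_cancel_right]
      · rw [← mul_inv]
        exact inv_ne_one.2 t₀_mul_t₁_ne_one
    · rw [eval_negLaurent t₀_ne_zero (neg_ne_zero.2 (inv_ne_zero t₀_ne_zero)),
        negTwist_specialization (by rw [inv_neg, inv_inv, mul_neg, inv_mul_cancel₀ t₀_ne_zero])]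
      push_cast
      rw [inv_neg, inv_inv]
      ring
  · obtain ⟨m, rfl⟩ : ∃ m : ℕ, n = -m := ⟨(-n).toNat, by omega⟩
    refine ⟨posLaurent m, isLinksGould_of_diagramOp fun p q y hp hq hy hp0 hq0 j => ?_, fun h => ?_,
      by omega, fun _ => ?_, fun h => span_posLaurent (by simpa using h), ?_⟩
    · rw [eval_posLaurent t₀_ne_zero t₁_ne_zero, diagramOp_posTwist hp0 hq0 (by rw [hp, hq, hy]),
        hp, hq]
    · obtain rfl : m = 0 := by simpa using h
      simp [posLaurent, posTwist, twistSequence]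
    · rw [eval_posLaurent t₀_ne_zero t₁_ne_zero,
        posTwist_eq t₀_ne_zero t₁_ne_zero t₀_mul_t₁_ne_one, neg_neg]
      push_cast
      ring
    · rw [eval_posLaurent t₀_ne_zero (neg_ne_zero.2 (inv_ne_zero t₀_ne_zero)),
        posTwist_specialization (by rw [inv_neg, inv_inv, mul_neg, inv_mul_cancel₀ t₀_ne_zero])
          (by rw [inv_neg, inv_inv, neg_neg]) rfl]
      push_cast
      rw [inv_neg, inv_inv]
      ring
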